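/- **Grün's Lemma.** Let $\mathcal{X}$ be a semi-abelian category (pointed, Barr-exact, Bourn-protomodular, with binary coproducts). For subobjects $K,L\le X$ let $[K,L]\le X$ denote their Higgins commutator: the image of $K\diamond L\to K+L\to X$, where $K\diamond L$ is the kernel of the canonical morphism $K+L\to K\times L$. An object $X$ is *perfect* if $[X,X]=X$. The *centre* $Z(X)$ is the largest subobject $Z\le X$ with $[X,Z]=0$; $\mathcal{X}$ *admits centres* if every object has one. A *central extension* is a regular epimorphism $f\colon X\to Y$ whose kernel pair Smith-commutes with the largest equivalence relation $\nabla_X$ on $X$. $\mathcal{X}$ satisfies *(UCE)* if for all central extensions $f\colon A\to B$ and $g\colon B\to C$ with $B$ perfect, $g\circ f$ is a central extension. 1. If $\mathcal{X}$ admits centres and satisfies (UCE), then for every perfect object $P$ the quotient $P/Z(P)$ (the cokernel of $Z(P)\to P$) exists and has trivial centre, $Z(P/Z(P))=0$. 2. This applies in particular to any category of interest: each such category is semi-abelian, admits centres and satisfies (UCE). Here a *category of interest* (Orzech) is a variety of groups $(0,+,-)$, not necessarily commutative, with a set $\Omega_1'$ of further unary operations and a set $\Omega_2'$ of further binary operations,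 possibly satisfying further identities, in which: for each $*\in\Omega_2'$ the opposite operation $x*^{\circ}y=y*x$ is in $\Omega_2'$; for $*\in\Omega_2'$ and $\omega\in\Omega_1'$ the identities $x*(y+z)=x*y+x*z$, $\omega(x+y)=\omega(x)+\omega(y)$, $\omega(x)*y=\omega(x*y)$ and $x_1+(x_2*x_3)=(x_2*x_3)+x_1$ hold; and for all $*,\bar *\in\Omega_2'$ there is a word $W$ such that $(x_1*x_2)\,\bar *\,x_3$ is identically equal to $W$ evaluated at monomials of the forms $x_1(x_2x_3)$, $x_1(x_3x_2)$, $(x_2x_3)x_1$, $(x_3x_2)x_1$, $x_2(x_1x_3)$, $x_2(x_3x_1)$, $(x_1x_3)x_2$, $(x_3x_1)x_2$, where each juxtaposition stands for an operation in $\Omega_2'$. -/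

import Mathlib

open CategoryTheory CategoryTheory.Limits

universe w v u

namespace SemiAb

section General

variable (C : Type u) [Category.{v} C]

/-- A Barr-exact category: a regular category in which every internal equivalence relation is
effective, i.e. is the kernel pair of its quotient. -/
class BarrExact : Prop extends Regular C where
  effective : ∀ {R X : C} (p₁ p₂ : R ⟶ X), IsEquivalenceRelation p₁ p₂ →
    IsEffectiveEquivalenceRelation p₁ p₂

/-- A semi-abelian category (in the sense of Janelidze, Márki and Tholen): pointed, Barr-exact,
with binary coproducts, and protomodular. In the presence of a zero object and finite limits,
protomodularity is the split short five lemma: a morphism `(θ, φ)` of points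
`(f', s') ⟶ (f, s)` for which `φ` and the induced morphism on kernels are isomorphisms is itself
an isomorphism. -/
class SemiAbelian [HasZeroMorphisms C] : Prop extends BarrExact C where
  hasZeroObject : HasZeroObject C
  hasBinaryCoproducts : HasBinaryCoproducts C
  protomodular : ∀ {X' Y' X Y : C} (f' : X' ⟶ Y') (s' : Y' ⟶ X') (f : X ⟶ Y) (s : Y ⟶ X)
    (θ : X' ⟶ X) (φ : Y' ⟶ Y), s' ≫ f' = 𝟙 Y' → s ≫ f = 𝟙 Y →
    ∀ hf : f' ≫ φ = θ ≫ f, s' ≫ θ = φ ≫ s →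
    IsIso φ → IsIso (kernel.map f' f θ φ hf) → IsIso θ

attribute [instance] SemiAbelian.hasZeroObject SemiAbelian.hasBinaryCoproducts

end General

section Commutators

variable {C : Type u} [Category.{v} C] [HasZeroMorphisms C] [SemiAbelian C]

/-- The canonical morphism `K + L ⟶ K × L`. -/
noncomputable def coprodToProd (K L : C) : K ⨿ L ⟶ K ⨯ L :=
  coprod.desc (prod.lift (𝟙 K) 0) (prod.lift 0 (𝟙 L))

/-- The co-smash product of `K` and `L`. -/
noncomputable def cosmash (K L : C) : C := kernel (coprodToProd K L)

/-- The inclusion of the co-smash product into the coproduct. -/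
noncomputable def cosmashInclusion (K L : C) : cosmash K L ⟶ K ⨿ L := kernel.ι (coprodToProd K L)

/-- The Higgins commutator `[K, L] ≤ X` of two subobjects of `X`. -/
noncomputable def higgins {X : C} (K L : Subobject X) : Subobject X :=
  imageSubobject (cosmashInclusion (K : C) (L : C) ≫ coprod.desc K.arrow L.arrow)

/-- An object is perfect when `[X, X] = X`. -/
def IsPerfect (X : C) : Prop := higgins (⊤ : Subobject X) ⊤ = ⊤

variable (C) in
/-- `C` admits centres: for each `X` there is a largest subobject `Z` of `X` with `[X, Z] = 0`. -/
def AdmitsCentres : Prop :=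
  ∀ X : C, ∃ Z : Subobject X, IsGreatest {Z : Subobject X | higgins ⊤ Z = ⊥} Z

/-- The centre `Z(X)` of `X`. -/
noncomputable def centre (hC : AdmitsCentres C) (X : C) : Subobject X := (hC X).choose

/-- The equivalence relations `R` and `S` on `X` centralise each other (Smith-commute): there is
`θ : R ×_X S ⟶ X` with `θ(x, y, y) = x` and `θ(x, x, y) = y`. -/
def SmithCommute {X R S : C} {r₁ r₂ : R ⟶ X} {s₁ s₂ : S ⟶ X}
    (hR : EquivalenceRelation r₁ r₂) (hS : EquivalenceRelation s₁ s₂) : Prop :=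
  ∃ θ : pullback r₂ s₁ ⟶ X,
    pullback.lift (𝟙 R) (r₂ ≫ hS.r) (by simp) ≫ θ = r₁ ∧
    pullback.lift (s₁ ≫ hR.r) (𝟙 S) (by simp) ≫ θ = s₂

/-- The kernel pair `Eq(f)`, as an equivalence relation. -/
noncomputable def kernelPairRel {X Y : C} (f : X ⟶ Y) :
    EquivalenceRelation (pullback.fst f f) (pullback.snd f f) :=
  IsKernelPair.equivalenceRelation f _ _
    (pullbackIsPullback (pullback.snd f f) (pullback.fst f f)) (IsPullback.of_hasPullback f f)

/-- The largest equivalence relation `∇` on `X`, i.e. `X × X` with its two projections. -/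
noncomputable def nablaRel (X : C) :
    EquivalenceRelation (prod.fst : X ⨯ X ⟶ X) (prod.snd : X ⨯ X ⟶ X) :=
  IsKernelPair.equivalenceRelation (terminal.from X) _ _
    (pullbackIsPullback (prod.snd : X ⨯ X ⟶ X) (prod.fst : X ⨯ X ⟶ X))
    (IsPullback.of_is_product' (prodIsProd X X) terminalIsTerminal)

/-- A central extension: a regular epimorphism whose kernel pair is a central equivalence
relation, i.e. centralises the largest equivalence relation on the domain. -/
def IsCentralExtension {X Y : C} (f : X ⟶ Y) : Prop :=
  IsRegularEpi f ∧ SmithCommute (kernelPairRel f) (nablaRel X)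

variable (C) in
/-- The universal central extension condition. -/
def UCE : Prop :=
  ∀ {A B D : C} (f : A ⟶ B) (g : B ⟶ D), IsCentralExtension f → IsCentralExtension g →
    IsPerfect B → IsCentralExtension (f ≫ g)

end Commutators

/-! Categories of interest in the sense of Orzech. -/

/-- Words in the group operations `0, +, -`, the further unary operations `Un` and the further
binary operations `Bin`, in variables from `V`. -/
inductive Word (Un Bin : Type w) (V : Type u) : Type (max w u)
  | var (i : V) : Word Un Bin V
  | zero : Word Un Bin V
  | add (a b : Word Un Bin V) : Word Un Bin V
  | neg (a : Word Un Bin V) : Word Un Bin V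
  | un (ω : Un) (a : Word Un Bin V) : Word Un Bin V
  | bin (s : Bin) (a b : Word Un Bin V) : Word Un Bin V

/-- A (not necessarily commutative) additive group with operations. -/
class GroupWithOps (Un Bin : Type w) (A : Type u) extends AddGroup A where
  un : Un → A → A
  bin : Bin → A → A → A

/-- Evaluation of a word. -/
def Word.eval {Un Bin : Type w} {V : Type v} {A : Type u} [GroupWithOps Un Bin A] (x : V → A) :
    Word Un Bin V → A
  | .var i => x i
  | .zero => 0
  | .add a b => a.eval x + b.eval x
  | .neg a => - a.eval x
  | .un ω a => GroupWithOps.un Bin ω (a.eval x)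
  | .bin s a b => GroupWithOps.bin Un s (a.eval x) (b.eval x)

/-- A presentation of a variety of groups with operations: unary and binary operations besides
the group operations, and a set of identities besides the group laws. -/
structure Theory where
  Un : Type w
  Bin : Type w
  identities : Set (Word Un Bin ℕ × Word Un Bin ℕ)

namespace Theory

variable (T : Theory.{w})

/-- The groups with operations satisfying all identities of `T`. -/
structure Model where
  carrier : Type w
  [ops : GroupWithOps T.Un T.Bin carrier]
  sat : ∀ e ∈ T.identities, ∀ x : ℕ → carrier, e.1.eval x = e.2.eval x

instance : CoeSort T.Model (Type w) := ⟨Model.carrier⟩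

instance (A : T.Model) : GroupWithOps T.Un T.Bin A := A.ops

variable {T}

instance (A : T.Model) : AddGroup A := (inferInstance : GroupWithOps T.Un T.Bin A).toAddGroup

/-- A further unary operation on a model. -/
def Model.un {A : T.Model} (ω : T.Un) (x : A) : A := GroupWithOps.un T.Bin ω x

/-- A further binary operation on a model. -/
def Model.bin {A : T.Model} (s : T.Bin) (x y : A) : A := GroupWithOps.bin T.Un s x y

/-- Homomorphisms of models. -/
@[ext]
structure Model.Hom (A B : T.Model) where
  toFun : A → B
  map_add : ∀ x y, toFun (x + y) = toFun x + toFun y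
  map_un : ∀ (ω : T.Un) (x : A), toFun (Model.un ω x) = Model.un ω (toFun x)
  map_bin : ∀ (s : T.Bin) (x y : A),
    toFun (Model.bin s x y) = Model.bin s (toFun x) (toFun y)

instance : Category.{w} T.Model where
  Hom := Model.Hom
  id A := ⟨id, fun _ _ => rfl, fun _ _ => rfl, fun _ _ _ => rfl⟩
  comp f g := ⟨g.toFun ∘ f.toFun, fun _ _ => by simp [f.map_add, g.map_add],
    fun _ _ => by simp [f.map_un, g.map_un], fun _ _ _ => by simp [f.map_bin, g.map_bin]⟩

/-- The eight types of monomials `x₁(x₂x₃)`, `x₁(x₃x₂)`, `(x₂x₃)x₁`, `(x₃x₂)x₁`, `x₂(x₁x₃)`,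
`x₂(x₃x₁)`, `(x₁x₃)x₂`, `(x₃x₁)x₂`, with outer operation `s` and inner operation `t`. -/
def Model.monomial {A : T.Model} (x₁ x₂ x₃ : A) (s t : T.Bin) : Fin 8 → A :=
  ![bin s x₁ (bin t x₂ x₃), bin s x₁ (bin t x₃ x₂), bin s (bin t x₂ x₃) x₁,
    bin s (bin t x₃ x₂) x₁, bin s x₂ (bin t x₁ x₃), bin s x₂ (bin t x₃ x₁),
    bin s (bin t x₁ x₃) x₂, bin s (bin t x₃ x₁) x₂]

variable (T)

/-- The variety of models of `T` is a category of interest. -/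
structure IsOfInterest : Prop where
  opposite : ∀ s : T.Bin, ∃ s' : T.Bin, ∀ (A : T.Model) (x y : A),
    Model.bin s' x y = Model.bin s y x
  bin_add : ∀ (s : T.Bin) (A : T.Model) (x y z : A),
    Model.bin s x (y + z) = Model.bin s x y + Model.bin s x z
  un_add : ∀ (ω : T.Un) (A : T.Model) (x y : A),
    Model.un ω (x + y) = Model.un ω x + Model.un ω y
  un_bin : ∀ (ω : T.Un) (s : T.Bin) (A : T.Model) (x y : A),
    Model.bin s (Model.un ω x) y = Model.un ω (Model.bin s x y)
  add_bin : ∀ (s : T.Bin) (A : T.Model) (x₁ x₂ x₃ : A),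
    x₁ + Model.bin s x₂ x₃ = Model.bin s x₂ x₃ + x₁
  bin_bin : ∀ s t : T.Bin, ∃ W : Word T.Un T.Bin (Fin 8 × T.Bin × T.Bin),
    ∀ (A : T.Model) (x₁ x₂ x₃ : A),
      Model.bin t (Model.bin s x₁ x₂) x₃ =
        W.eval (fun v => Model.monomial x₁ x₂ x₃ v.2.1 v.2.2 v.1)

end Theory

end SemiAb

/-! Write `q : P ⟶ P/Z(P)` and let `Z'` be the centre of `P/Z(P)`. Both `q` and the quotient by `Z'`
are central extensions, and `P/Z(P)` is perfect, being a quotient of `P`. By (UCE) the composite is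
central, so its kernel is central in `P`, hence lies in `Z(P)` and is killed by `q`. But `q` maps
this kernel onto `Z'`, so `Z' = 0`.

The common language is a `Cooperator`, a morphism `X × K ⟶ X` acting as `(x, z) ↦ x + z`. It encodes
`[X, K] = 0` (`higgins_top_eq_bot_iff`). It also makes a central subobject the kernel of a regular
epimorphism (`exists_cokernel`, by Barr-exactness) and translates Smith-centrality of `f` into
centrality of its kernel.

In a category of interest, cooperation means commuting with and annihilating everything. (UCE) is
`isCentral_of_comp`: if `f : A ⟶ B` is central, `B` is perfect and `f k` is central, then `x ↦ x + k
- x - k` and `x ↦ x * k` are additive maps on `A`. They vanish on the kernel of `f`, on commutators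
and on products. Since `B` is generated by commutators and products, they vanish everywhere. -/

namespace SemiAb

/-! ### Consequences of protomodularity for products, kernels and regular epimorphisms. -/

section General

attribute [local simp] prod.lift_fst prod.lift_snd prod.lift_fst_assoc prod.lift_snd_assoc
  coprod.inl_desc coprod.inr_desc coprod.inl_desc_assoc coprod.inr_desc_assoc
  pullback.lift_fst pullback.lift_snd pullback.lift_fst_assoc pullback.lift_snd_assoc

variable {C : Type u} [Category.{v} C] [HasZeroMorphisms C] [SemiAbelian C]

/-- In a point, the section and the kernel are jointly extremally epic. -/
lemma isIso_of_point {M A B K : C} (m : M ⟶ A) [Mono m] (f : A ⟶ B) (s : B ⟶ A)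
    (hs : s ≫ f = 𝟙 B) (k : K ⟶ A) (hk : ∀ {W : C} (t : W ⟶ A), t ≫ f = 0 → ∃ l, l ≫ k = t)
    (s' : B ⟶ M) (hs' : s' ≫ m = s) (k' : K ⟶ M) (hk' : k' ≫ m = k) : IsIso m := by
  -- `m` is a morphism of points over `𝟙 B`; only its restriction to kernels remains to be inverted.
  refine SemiAbelian.protomodular (m ≫ f) s' f s m (𝟙 B) (by simp [reassoc_of% hs', hs]) hs
    (by simp) (by simp [hs']) inferInstance ?_
  obtain ⟨l, hl⟩ := hk (kernel.ι f) (kernel.condition f)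
  refine ⟨kernel.lift _ (l ≫ k') ?_, ?_, ?_⟩
  · rw [Category.assoc, reassoc_of% hk', reassoc_of% hl, kernel.condition]
  · rw [← cancel_mono (kernel.ι _), ← cancel_mono m]
    simp [hk', hl]
  · rw [← cancel_mono (kernel.ι _)]
    simp [hk', hl]

/-- In a point, morphisms agreeing on the section and on the kernel are equal. -/
lemma point_hom_ext {A B K Y : C} (f : A ⟶ B) (s : B ⟶ A)
    (hs : s ≫ f = 𝟙 B) (k : K ⟶ A) (hk : ∀ {W : C} (t : W ⟶ A), t ≫ f = 0 → ∃ l, l ≫ k = t)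
    {g h : A ⟶ Y} (h₁ : s ≫ g = s ≫ h) (h₂ : k ≫ g = k ≫ h) : g = h := by
  have := isIso_of_point (equalizer.ι g h) f s hs k hk (equalizer.lift s h₁) (by simp)
    (equalizer.lift k h₂) (by simp)
  rw [← cancel_epi (equalizer.ι g h), equalizer.condition]

lemma prod_kernel_snd (X Y : C) {W : C} (t : W ⟶ X ⨯ Y) (ht : t ≫ prod.snd = 0) :
    ∃ l, l ≫ prod.lift (𝟙 X) (0 : X ⟶ Y) = t :=
  ⟨t ≫ prod.fst, by ext <;> simp [ht]⟩

/-- The projection to `Y` is a point with kernel `X`, so the two injections are jointly extremally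
epic. -/
lemma prod_isIso {M X Y : C} (m : M ⟶ X ⨯ Y) [Mono m] (a : X ⟶ M) (b : Y ⟶ M)
    (ha : a ≫ m = prod.lift (𝟙 X) 0) (hb : b ≫ m = prod.lift 0 (𝟙 Y)) : IsIso m :=
  isIso_of_point m prod.snd (prod.lift 0 (𝟙 Y)) (by simp) (prod.lift (𝟙 X) 0)
    (prod_kernel_snd X Y) b hb a ha

lemma prod_hom_ext {X Y W : C} {g h : X ⨯ Y ⟶ W}
    (h₁ : prod.lift (𝟙 X) 0 ≫ g = prod.lift (𝟙 X) 0 ≫ h)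
    (h₂ : prod.lift 0 (𝟙 Y) ≫ g = prod.lift 0 (𝟙 Y) ≫ h) : g = h :=
  point_hom_ext prod.snd (prod.lift 0 (𝟙 Y)) (by simp) (prod.lift (𝟙 X) 0)
    (prod_kernel_snd X Y) h₂ h₁

/-- A factorisation of the two injections of a product through a mono extends to the product. -/
lemma prod_lift_of_mono {X Y W V : C} (g : X ⨯ Y ⟶ V) (m : W ⟶ V) [Mono m]
    (a : X ⟶ W) (b : Y ⟶ W) (ha : a ≫ m = prod.lift (𝟙 X) 0 ≫ g)
    (hb : b ≫ m = prod.lift 0 (𝟙 Y) ≫ g) : ∃ l : X ⨯ Y ⟶ W, l ≫ m = g := by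
  -- The pullback of `m` along `g` is a subobject of `X ⨯ Y` containing both injections.
  have := prod_isIso (pullback.fst g m) (pullback.lift _ _ ha.symm) (pullback.lift _ _ hb.symm)
    (by simp) (by simp)
  exact ⟨inv (pullback.fst g m) ≫ pullback.snd g m, by simp [← pullback.condition]⟩

instance (X Y : C) : StrongEpi (coprodToProd X Y) := by
  obtain ⟨F⟩ := HasStrongEpiMonoFactorisations.has_fac (coprodToProd X Y)
  have : IsIso F.m := by
    refine prod_isIso F.m (coprod.inl ≫ F.e) (coprod.inr ≫ F.e) ?_ ?_ <;>
    simp [coprodToProd]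
  rw [← F.fac]
  exact strongEpi_comp _ _

/-- The kernel pair is a point over `X`, split by the diagonal. Its kernel is that of `f`, hence
zero, so the two projections are determined by the diagonal and agree. -/
lemma mono_of_kernel_zero {X Y : C} (f : X ⟶ Y)
    (hf : ∀ {W : C} (t : W ⟶ X), t ≫ f = 0 → t = 0) : Mono f := by
  have hk := IsKernelPair.of_hasPullback f
  refine hk.mono_of_eq_fst_snd ?_
  refine point_hom_ext (pullback.fst f f) (pullback.lift (𝟙 X) (𝟙 X) rfl) (by simp)
    (0 : X ⟶ _) (fun {W} t ht => ⟨0, ?_⟩) (by simp) (by simp)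
  have h2 : t ≫ pullback.snd f f = 0 := hf _ (by
    rw [Category.assoc, ← pullback.condition, reassoc_of% ht, zero_comp])
  ext <;> simp [ht, h2]

/-- A regular epimorphism is the cokernel of its kernel. -/
lemma desc_of_kernel_comp {X Y W : C} (f : X ⟶ Y) [IsRegularEpi f] (g : X ⟶ W)
    (hg : kernel.ι f ≫ g = 0) : ∃ l : Y ⟶ W, f ≫ l = g := by
  -- The kernel pair is covered by the diagonal and by the pairs `(0, z)` with `z` in the kernel of
  -- `f`.
  have h : pullback.fst f f ≫ g = pullback.snd f f ≫ g := by
    refine point_hom_ext (pullback.fst f f) (pullback.lift (𝟙 X) (𝟙 X) rfl) (by simp)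
      (pullback.lift 0 (kernel.ι f) (by simp)) (fun {W} t ht => ?_) (by simp) (by simp [hg])
    refine ⟨kernel.lift f (t ≫ pullback.snd f f) ?_, ?_⟩
    · rw [Category.assoc, ← pullback.condition, reassoc_of% ht, zero_comp]
    · ext <;> simp [ht]
  obtain ⟨r⟩ := IsRegularEpi.regularEpi (f := f)
  have h' : r.left ≫ g = r.right ≫ g := by
    have := pullback.lift r.left r.right r.w ≫= h
    simpa using this
  exact ⟨_, (Cofork.IsColimit.desc' r.isColimit g h').2⟩

/-! ### Cooperators and the Higgins commutator. -/

/-- The morphism `k` cooperates with the identity of `X`: there is `φ : X × K ⟶ X` with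
`φ(x, 0) = x` and `φ(0, z) = k(z)`. -/
structure Cooperator {X K : C} (k : K ⟶ X) where
  φ : X ⨯ K ⟶ X
  inl : prod.lift (𝟙 X) 0 ≫ φ = 𝟙 X
  inr : prod.lift 0 (𝟙 K) ≫ φ = k


lemma higgins_eq_bot_iff {X : C} (K L : Subobject X) : higgins K L = ⊥ ↔
    cosmashInclusion (K : C) (L : C) ≫ coprod.desc K.arrow L.arrow = 0 := by
  constructor
  · intro h
    have h2 := imageSubobject_arrow_comp
      (cosmashInclusion (K : C) (L : C) ≫ coprod.desc K.arrow L.arrow)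
    have h3 : (higgins K L).arrow = 0 := by rw [h]; exact Subobject.bot_arrow
    rw [← h2]
    unfold higgins at h3
    rw [h3, comp_zero]
  · intro h
    unfold higgins
    simp only [h]
    exact imageSubobject_zero

/-- `coprodToProd` is a regular epimorphism, hence the cokernel of `cosmashInclusion`: the
commutator vanishes exactly when the copairing factors through the product. -/
lemma higgins_top_eq_bot_iff {X : C} (K : Subobject X) :
    higgins ⊤ K = ⊥ ↔ Nonempty (Cooperator K.arrow) := by
  rw [higgins_eq_bot_iff]
  constructor
  · intro h
    obtain ⟨l, hl⟩ := desc_of_kernel_comp (coprodToProd _ _) _ h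
    have h1 : prod.lift (𝟙 _) 0 ≫ l = (⊤ : Subobject X).arrow := by
      have := coprod.inl ≫= hl
      simpa [coprodToProd] using this
    have h2 : prod.lift 0 (𝟙 _) ≫ l = K.arrow := by
      have := coprod.inr ≫= hl
      simpa [coprodToProd] using this
    refine ⟨⟨prod.map (inv (⊤ : Subobject X).arrow) (𝟙 _) ≫ l, ?_, ?_⟩⟩
    · have h : prod.lift (𝟙 X) 0 ≫ prod.map (inv (⊤ : Subobject X).arrow) (𝟙 (K : C)) =
          inv (⊤ : Subobject X).arrow ≫ prod.lift (𝟙 _) 0 := by ext <;> simp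
      rw [reassoc_of% h, h1, IsIso.inv_hom_id]
    · rw [← Category.assoc, ← h2]
      congr 1
      ext <;> simp
  · rintro ⟨c⟩
    have : coprod.desc (⊤ : Subobject X).arrow K.arrow =
        coprodToProd _ _ ≫ prod.map (⊤ : Subobject X).arrow (𝟙 _) ≫ c.φ := by
      ext
      · have h : prod.lift (⊤ : Subobject X).arrow (0 : _ ⟶ (K : C)) =
          (⊤ : Subobject X).arrow ≫ prod.lift (𝟙 X) 0 := by ext <;> simp
        rw [coprod.inl_desc, coprodToProd, coprod.inl_desc_assoc, prod.lift_map_assoc,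
          Category.id_comp, zero_comp, h, Category.assoc, c.inl, Category.comp_id]
      · simp [coprodToProd, c.inr]
    rw [this]
    exact (kernel.condition_assoc _ _).trans zero_comp

/-! ### Central subobjects are kernels. -/

namespace Cooperator

variable {X K : C} {k : K ⟶ X} (c : Cooperator k)

lemma lift_zero_right {W : C} (a : W ⟶ X) : prod.lift a 0 ≫ c.φ = a := by
  have : prod.lift a (0 : W ⟶ K) = a ≫ prod.lift (𝟙 X) 0 := by ext <;> simp
  rw [this, Category.assoc, c.inl, Category.comp_id]

lemma lift_zero_left {W : C} (a : W ⟶ K) : prod.lift 0 a ≫ c.φ = a ≫ k := by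
  have : prod.lift (0 : W ⟶ X) a = a ≫ prod.lift 0 (𝟙 K) := by ext <;> simp
  rw [this, Category.assoc, c.inr]

lemma mono_lift [Mono k] : Mono (prod.lift prod.fst c.φ) := by
  refine mono_of_kernel_zero _ fun {W} t ht => ?_
  have h1 : t ≫ prod.fst = 0 := by simpa using ht =≫ prod.fst
  have h2 : t ≫ c.φ = 0 := by simpa using ht =≫ prod.snd
  have h3 : t = prod.lift 0 (t ≫ prod.snd) := by ext <;> simp [h1]
  rw [h3, c.lift_zero_left, ← zero_comp (f := k), cancel_mono] at h2
  rw [h3, h2]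
  ext <;> simp

/-- The group structure of a central subobject. -/
lemma exists_mul [Mono k] : ∃ μ : K ⨯ K ⟶ K, μ ≫ k = prod.map k (𝟙 K) ≫ c.φ := by
  refine prod_lift_of_mono _ k (𝟙 K) (𝟙 K) ?_ ?_
  · simp [c.lift_zero_right]
  · simp [c.inr]

/-- The shear `(x, y) ↦ (x, x + y)` of `K ⨯ K` is invertible by the split short five lemma; the
second coordinate of its inverse at `(x, 0)` is `-x`. -/
lemma exists_neg [Mono k] : ∃ ν : K ⟶ K, prod.lift k ν ≫ c.φ = 0 := by
  obtain ⟨μ, hμ⟩ := c.exists_mul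
  have h1 : prod.lift (𝟙 K) 0 ≫ μ = 𝟙 K := by
    rw [← cancel_mono k, Category.assoc, hμ]
    simp [c.lift_zero_right]
  have h2 : prod.lift 0 (𝟙 K) ≫ μ = 𝟙 K := by
    rw [← cancel_mono k, Category.assoc, hμ]
    simp [c.inr]
  have hi : IsIso (prod.lift prod.fst μ) := by
    refine SemiAbelian.protomodular prod.fst (prod.lift (𝟙 K) 0) prod.fst (prod.lift (𝟙 K) (𝟙 K))
      (prod.lift prod.fst μ) (𝟙 K) (by simp) (by simp) (by simp) (by simp [h1]) inferInstance ?_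
    have e : ∀ {W : C} (a : W ⟶ K), prod.lift 0 a ≫ μ = a := fun a => by
      have : prod.lift (0 : _ ⟶ K) a = a ≫ prod.lift 0 (𝟙 K) := by ext <;> simp
      rw [this, Category.assoc, h2, Category.comp_id]
    have e2 : ∀ {W : C} (t : W ⟶ K ⨯ K), t ≫ prod.fst = 0 → prod.lift 0 (t ≫ prod.snd) = t :=
      fun t ht => by ext <;> simp [ht]
    have e3 : kernel.ι (prod.fst : K ⨯ K ⟶ K) ≫ μ = kernel.ι prod.fst ≫ prod.snd := by
      conv_lhs => rw [← e2 (kernel.ι prod.fst) (kernel.condition _)]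
      rw [e]
    convert (inferInstance : IsIso (𝟙 (kernel (prod.fst : K ⨯ K ⟶ K))))
    rw [← cancel_mono (kernel.ι _)]
    ext <;> simp [e3]
  refine ⟨prod.lift (𝟙 K) 0 ≫ inv (prod.lift prod.fst μ) ≫ prod.snd, ?_⟩
  have h3 : inv (prod.lift prod.fst μ) ≫ prod.fst = prod.fst := by simp
  have h4 : inv (prod.lift prod.fst μ) ≫ μ = prod.snd := by simp
  have h5 : prod.lift k (prod.lift (𝟙 K) 0 ≫ inv (prod.lift prod.fst μ) ≫ prod.snd) =
      prod.lift (𝟙 K) 0 ≫ inv (prod.lift prod.fst μ) ≫ prod.map k (𝟙 K) := by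
    ext
    · simp [reassoc_of% h3]
    · simp
  rw [h5, Category.assoc, Category.assoc, ← hμ, reassoc_of% h4]
  simp

/-- The equivalence relation `(x, z) ↦ (x, x + z)` attached to a central subobject. -/
lemma isEquivalenceRelation [Mono k] : IsEquivalenceRelation prod.fst c.φ := by
  obtain ⟨μ, hμ⟩ := c.exists_mul
  obtain ⟨ν, hν⟩ := c.exists_neg
  have hm := c.mono_lift
  -- Symmetry, in the form `(x + z) + (-z) = x`.
  have hs : prod.lift c.φ (prod.snd ≫ ν) ≫ c.φ = prod.fst := by
    apply prod_hom_ext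
    · rw [← Category.assoc, prod.comp_lift, c.inl, prod.lift_fst]
      simp [c.lift_zero_right]
    · rw [← Category.assoc, prod.comp_lift, c.inr, prod.lift_fst]
      simpa using hν
  -- Transitivity, in the form `x + (z + w) = (x + z) + w`; it suffices to test it for `z = w = 0`
  -- and for `x = 0`.
  have ht : prod.map (𝟙 X) μ ≫ c.φ = prod.lift (prod.lift prod.fst (prod.snd ≫ prod.fst) ≫ c.φ)
      (prod.snd ≫ prod.snd) ≫ c.φ := by
    apply prod_hom_ext
    · simp only [← Category.assoc, prod.comp_lift]
      simp [c.lift_zero_right]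
    · simp only [← Category.assoc, prod.comp_lift]
      have h : prod.map k (𝟙 K) = prod.lift (prod.fst ≫ k) prod.snd := by ext <;> simp
      simp [c.lift_zero_left, hμ, h]
  refine ⟨⟨{
    right_cancellation := fun Y f g h₁ h₂ => by
      rw [← cancel_mono (prod.lift prod.fst c.φ)]
      ext <;> simp [h₁, h₂]
    r := prod.lift (𝟙 X) 0
    reflexivity₁ := by simp
    reflexivity₂ := c.inl
    s := prod.lift c.φ (prod.snd ≫ ν)
    symmetry₁ := by simp
    symmetry₂ := hs
    c := _
    isLimit := pullbackIsPullback c.φ prod.fst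
    t := prod.lift (pullback.fst _ _ ≫ prod.fst)
      (prod.lift (pullback.fst _ _ ≫ prod.snd) (pullback.snd _ _ ≫ prod.snd) ≫ μ)
    transitivity₁ := by simp [PullbackCone.fst]
    transitivity₂ := ?_ }⟩⟩
  change _ = pullback.snd _ _ ≫ c.φ
  have h := prod.lift (pullback.fst c.φ prod.fst ≫ prod.fst)
      (prod.lift (pullback.fst c.φ prod.fst ≫ prod.snd)
        (pullback.snd c.φ prod.fst ≫ prod.snd)) ≫= ht
  simp only [← Category.assoc, prod.comp_lift] at h
  simp only [prod.lift_map, Category.comp_id, prod.lift_fst, prod.lift_snd, ← prod.comp_lift,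
    Category.assoc] at h
  rw [prod.lift_fst_snd, Category.id_comp, pullback.condition] at h
  refine h.trans ?_
  have e2 : prod.lift (pullback.snd c.φ (prod.fst : X ⨯ K ⟶ X) ≫ prod.fst)
      (pullback.snd c.φ prod.fst ≫ prod.snd) = pullback.snd c.φ prod.fst := by
    ext <;> simp
  rw [e2]



/-- A central subobject is the kernel of its cokernel, and the kernel pair of this cokernel is
`X × K`. -/
lemma exists_cokernel [Mono k] : ∃ (B : C) (π : X ⟶ B) (h : k ≫ π = 0), IsRegularEpi π ∧
    IsKernelPair π prod.fst c.φ ∧ Nonempty (IsColimit (CokernelCofork.ofπ π h)) ∧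
    ∀ {W : C} (t : W ⟶ X), t ≫ π = 0 → ∃ a, a ≫ k = t := by
  obtain ⟨⟨-, B, π, hπ, hp⟩⟩ := BarrExact.effective _ _ c.isEquivalenceRelation
  have : IsRegularEpi π := ⟨⟨Cofork.IsColimit.regularEpi hp.isLimitFork⟩⟩
  have h : k ≫ π = 0 := by
    have := prod.lift 0 (𝟙 K) ≫= hπ.w
    rw [← Category.assoc, ← Category.assoc, c.inr] at this
    rw [← this]
    simp
  have hl : ∀ {W : C} (t : W ⟶ X), t ≫ π = 0 → ∃ a, a ≫ k = t := fun t ht => by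
    have h0 : (0 : _ ⟶ X) ≫ π = t ≫ π := by simp [ht]
    have h1 := hπ.lift_fst _ _ h0
    have h2 := hπ.lift_snd _ _ h0
    -- An element killed by `π` is related to `0`, so it is `φ(0, a) = k(a)` for some `a`.
    have h3 : hπ.lift _ _ h0 = prod.lift 0 (hπ.lift _ _ h0 ≫ prod.snd) := by
      ext
      · simp
      · simp
    rw [h3, c.lift_zero_left] at h2
    exact ⟨_, h2⟩
  obtain ⟨a, ha⟩ := hl (kernel.ι π) (kernel.condition π)
  have hd : ∀ {W : C} (g : X ⟶ W), k ≫ g = 0 → ∃ l, π ≫ l = g := fun g hg =>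
    desc_of_kernel_comp π g (by rw [← ha, Category.assoc, hg, comp_zero])
  choose d hd using @hd
  exact ⟨B, π, h, this, hπ, ⟨CokernelCofork.IsColimit.ofπ _ _ (fun g hg => d g hg)
    (fun g hg => hd g hg) (fun g hg m hm => by rw [← cancel_epi π, hm, hd])⟩, hl⟩

/-- Cooperation restricts along morphisms. -/
noncomputable def comp {L : C} (l : L ⟶ K) : Cooperator (l ≫ k) where
  φ := prod.map (𝟙 X) l ≫ c.φ
  inl := by rw [prod.lift_map_assoc, Category.id_comp, zero_comp, c.inl]
  inr := by rw [prod.lift_map_assoc, Category.id_comp, zero_comp, c.lift_zero_left]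

end Cooperator

/-! ### Smith-central extensions and central kernels. -/

lemma kernelPairRel_r {X Y : C} (f : X ⟶ Y) :
    (kernelPairRel f).r = pullback.lift (𝟙 X) (𝟙 X) rfl := by
  ext <;> simp

lemma nablaRel_r (X : C) : (nablaRel X).r = prod.lift (𝟙 X) (𝟙 X) := by
  ext <;> simp

lemma exists_cooperator_of_isCentralExtension {X Y K : C} {f : X ⟶ Y}
    (hf : IsCentralExtension f) (k : K ⟶ X) (hk : k ≫ f = 0) : Nonempty (Cooperator k) := by
  obtain ⟨-, θ, h₁, h₂⟩ := hf
  have e : (k ≫ f) = 0 ≫ f := by simp [hk]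
  -- The cooperator is `(x, z) ↦ θ(z, 0, x)`, which reads as `z - 0 + x`.
  let ψ : X ⨯ K ⟶ pullback (pullback.snd f f) (prod.fst : X ⨯ X ⟶ X) :=
    pullback.lift (prod.snd ≫ pullback.lift k 0 e) (prod.lift 0 prod.fst) (by simp)
  refine ⟨⟨ψ ≫ θ, ?_, ?_⟩⟩
  · have h := prod.lift 0 (𝟙 X) ≫= h₂
    rw [prod.lift_snd, ← Category.assoc] at h
    rw [← Category.assoc]
    refine Eq.trans (congrArg (· ≫ θ) ?_) h
    ext <;> simp [kernelPairRel_r, ψ]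
  · have h := pullback.lift k 0 e ≫= h₁
    rw [pullback.lift_fst, ← Category.assoc] at h
    rw [← Category.assoc]
    refine Eq.trans (congrArg (· ≫ θ) ?_) h
    ext <;> simp [nablaRel_r, ψ]

/-- The connector is `θ(x, y, w) = w + (-y + x)`; the difference lies in `K` because the kernel pair
is `X × K`. -/
lemma Cooperator.isCentralExtension {X Y K : C} {k : K ⟶ X} (c : Cooperator k) {f : X ⟶ Y}
    (hf : IsKernelPair f prod.fst c.φ) [IsRegularEpi f] : IsCentralExtension f := by
  refine ⟨inferInstance, ?_⟩
  -- `a (x, y)` is the difference `- y + x`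
  let a : pullback f f ⟶ X ⨯ K := hf.lift (pullback.snd f f) (pullback.fst f f)
    pullback.condition.symm
  have ha₁ : a ≫ prod.fst = pullback.snd f f := hf.lift_fst _ _ _
  have ha₂ : a ≫ c.φ = pullback.fst f f := hf.lift_snd _ _ _
  have ha₃ : pullback.lift (𝟙 X) (𝟙 X) rfl ≫ a = prod.lift (𝟙 X) 0 := by
    apply hf.hom_ext
    · rw [Category.assoc, ha₁]; simp
    · rw [Category.assoc, ha₂, c.inl]; simp
  refine ⟨prod.lift (pullback.snd _ _ ≫ prod.snd) (pullback.fst _ _ ≫ a ≫ prod.snd) ≫ c.φ,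
    ?_, ?_⟩
  · rw [← Category.assoc, ← ha₂]
    congr 1
    ext
    · simp [nablaRel_r, ha₁]
    · simp
  · rw [← Category.assoc, prod.comp_lift, pullback.lift_snd_assoc, pullback.lift_fst_assoc, kernelPairRel_r,
      Category.assoc, reassoc_of% ha₃, prod.lift_snd, comp_zero, Category.id_comp,
      c.lift_zero_right]

/-- A regular epimorphism whose kernel is central is a central extension. -/
lemma Cooperator.isCentralExtension_of_kernel {X Y : C} (f : X ⟶ Y) [IsRegularEpi f]
    (c : Cooperator (kernel.ι f)) : IsCentralExtension f := by
  obtain ⟨B, π, h, hr, hπ, ⟨hc⟩, -⟩ := c.exists_cokernel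
  obtain ⟨d, hd⟩ := CokernelCofork.IsColimit.desc' hc f (kernel.condition f)
  obtain ⟨d', hd'⟩ := desc_of_kernel_comp f π h
  replace hd : π ≫ d = f := hd
  -- So `d` is a split mono, and `f = π ≫ d` has the same kernel pair as `π`.
  have h1 : d ≫ d' = 𝟙 B := by
    rw [← cancel_epi π, reassoc_of% hd, hd', Category.comp_id]
  have hm : Mono d := (SplitMono.mk d' h1).mono
  have hk := hπ.comp_of_mono (f₂ := d)
  rw [hd] at hk
  exact c.isCentralExtension hk

/-! ### Perfect objects, central quotients and Grün's Lemma. -/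

lemma imageSubobject_eq_top_iff {X Y : C} (f : X ⟶ Y) :
    imageSubobject f = ⊤ ↔ StrongEpi f := by
  unfold imageSubobject
  rw [← Subobject.isIso_iff_mk_eq_top]
  constructor
  · intro h
    rw [← image.fac f]
    exact strongEpi_comp _ _
  · intro h
    rw [← image.fac f] at h
    have := strongEpi_of_strongEpi (factorThruImage f) (image.ι f)
    exact isIso_of_mono_of_strongEpi _

/-- By naturality of the co-smash product, a strong epimorphism onto `Y` factors through the
commutator morphism of `Y`, which is therefore strong too. -/
lemma IsPerfect.of_regularEpi {X Y : C} (hX : IsPerfect X) (f : X ⟶ Y) [IsRegularEpi f] :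
    IsPerfect Y := by
  unfold IsPerfect higgins at *
  rw [imageSubobject_eq_top_iff] at *
  let g : ((⊤ : Subobject X) : C) ⟶ ((⊤ : Subobject Y) : C) :=
    (⊤ : Subobject X).arrow ≫ f ≫ inv (⊤ : Subobject Y).arrow
  have hg : g ≫ (⊤ : Subobject Y).arrow = (⊤ : Subobject X).arrow ≫ f := by simp [g]
  let m : cosmash ((⊤ : Subobject X) : C) ((⊤ : Subobject X) : C) ⟶
      cosmash ((⊤ : Subobject Y) : C) ((⊤ : Subobject Y) : C) :=
    kernel.map _ _ (coprod.map g g) (prod.map g g) (by ext <;> simp [coprodToProd])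
  have hm : m ≫ cosmashInclusion _ _ = cosmashInclusion _ _ ≫ coprod.map g g :=
    kernel.lift_ι _ _ _
  have h : m ≫ cosmashInclusion _ _ ≫
      coprod.desc (⊤ : Subobject Y).arrow (⊤ : Subobject Y).arrow =
      (cosmashInclusion _ _ ≫ coprod.desc (⊤ : Subobject X).arrow (⊤ : Subobject X).arrow) ≫
        f := by
    rw [reassoc_of% hm, Category.assoc]
    congr 1
    ext <;> simp [hg]
  have : StrongEpi (m ≫ cosmashInclusion _ _ ≫
      coprod.desc (⊤ : Subobject Y).arrow (⊤ : Subobject Y).arrow) := by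
    rw [h]
    exact strongEpi_comp _ _
  exact strongEpi_of_strongEpi m _

lemma exists_cooperator_centre (hC : AdmitsCentres C) (X : C) :
    Nonempty (Cooperator (centre hC X).arrow) :=
  (higgins_top_eq_bot_iff _).1 (hC X).choose_spec.1

lemma hasCokernel_centre (hC : AdmitsCentres C) (X : C) :
    HasCokernel (centre hC X).arrow := by
  obtain ⟨c⟩ := exists_cooperator_centre hC X
  obtain ⟨B, π, h, -, -, ⟨hc⟩, -⟩ := c.exists_cokernel
  exact ⟨_, hc⟩

lemma isCentralExtension_cokernel_centre (hC : AdmitsCentres C) (X : C)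
    [HasCokernel (centre hC X).arrow] :
    IsCentralExtension (cokernel.π (centre hC X).arrow) := by
  obtain ⟨c⟩ := exists_cooperator_centre hC X
  obtain ⟨B, π, h, -, -, -, hl⟩ := c.exists_cokernel
  obtain ⟨a, ha⟩ := hl (kernel.ι (cokernel.π (centre hC X).arrow)) (by
    rw [← cokernel.π_desc _ π h, kernel.condition_assoc, zero_comp])
  have : IsRegularEpi (cokernel.π (centre hC X).arrow) :=
    inferInstanceAs (IsRegularEpi (coequalizer.π _ _))
  exact Cooperator.isCentralExtension_of_kernel _ (ha ▸ c.comp a)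

lemma le_centre (hC : AdmitsCentres C) {X K : C} {k : K ⟶ X} [Mono k] (c : Cooperator k) :
    Subobject.mk k ≤ centre hC X := by
  refine (hC X).choose_spec.2 ((higgins_top_eq_bot_iff _).2 ⟨?_⟩)
  rw [← Subobject.underlyingIso_hom_comp_eq_mk]
  exact c.comp _

/-- Grün's Lemma. -/
theorem centre_cokernel_centre (hC : AdmitsCentres C) (hU : UCE C) (P : C) (hP : IsPerfect P)
    [HasCokernel (centre hC P).arrow] :
    centre hC (cokernel (centre hC P).arrow) = ⊥ := by
  have hq := isCentralExtension_cokernel_centre hC P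
  set q := cokernel.π (centre hC P).arrow with hqdef
  have := hasCokernel_centre hC (cokernel (centre hC P).arrow)
  have hq' := isCentralExtension_cokernel_centre hC (cokernel (centre hC P).arrow)
  set Z' := centre hC (cokernel (centre hC P).arrow) with hZ'
  have hreg : IsRegularEpi q := hq.1
  obtain ⟨c⟩ := exists_cooperator_of_isCentralExtension
    (hU q _ hq hq' (hP.of_regularEpi q)) (kernel.ι _) (kernel.condition _)
  have hle := le_centre hC c
  -- The kernel of the composite is central by (UCE), so it lies in the centre of `P`, which `q`
  -- kills.
  have h0 : kernel.ι (q ≫ cokernel.π Z'.arrow) ≫ q = 0 := by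
    rw [← Subobject.ofMkLE_arrow hle, Category.assoc, cokernel.condition, comp_zero]
  have h1 : pullback.snd Z'.arrow q ≫ q = 0 := by
    rw [← kernel.lift_ι (q ≫ cokernel.π Z'.arrow) (pullback.snd Z'.arrow q) (by
      rw [← pullback.condition_assoc, cokernel.condition, comp_zero]), Category.assoc, h0,
      comp_zero]
  rw [eq_bot_iff]
  refine Subobject.le_of_comm 0 ?_
  -- The pullback of `q` along `Z'.arrow` is epic, and its source lies in the kernel of the
  -- composite.
  rw [zero_comp, ← cancel_epi (pullback.fst Z'.arrow q), pullback.condition, h1, comp_zero]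

end General

/-! ### Homomorphisms, identities and constructions of models. -/

namespace Word

variable {Un Bin : Type w} {V : Type v}

lemma map_eval {A : Type*} {B : Type*} [GroupWithOps Un Bin A] [GroupWithOps Un Bin B] (f : A → B)
    (h_add : ∀ x y, f (x + y) = f x + f y)
    (h_un : ∀ (ω : Un) x, f (GroupWithOps.un Bin ω x) = GroupWithOps.un Bin ω (f x))
    (h_bin : ∀ (s : Bin) x y, f (GroupWithOps.bin Un s x y) = GroupWithOps.bin Un s (f x) (f y))
    (x : V → A) (W : Word Un Bin V) : f (W.eval x) = W.eval (fun i => f (x i)) := by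
  let φ : A →+ B := AddMonoidHom.mk' f h_add
  induction W with
  | var i => rfl
  | zero => exact map_zero φ
  | add a b ha hb => simp [eval, h_add, ha, hb]
  | neg a ha => rw [eval, eval, ← ha]; exact map_neg φ _
  | un ω a ha => simp [eval, h_un, ha]
  | bin s a b ha hb => simp [eval, h_bin, ha, hb]

end Word

namespace Theory

variable {T : Theory.{w}}

/-- Identities can be tested after a jointly injective family of homomorphisms into models; this
serves products, submodels and coproducts. -/
lemma sat_of_jointly_injective {X : Type*} [GroupWithOps T.Un T.Bin X] {ι : Sort*}
    (M : ι → T.Model) (F : ∀ i, X → M i)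
    (h_add : ∀ i x y, F i (x + y) = F i x + F i y)
    (h_un : ∀ i (ω : T.Un) x, F i (GroupWithOps.un T.Bin ω x) = Model.un ω (F i x))
    (h_bin : ∀ i (s : T.Bin) x y,
      F i (GroupWithOps.bin T.Un s x y) = Model.bin s (F i x) (F i y))
    (hF : ∀ x y, (∀ i, F i x = F i y) → x = y) :
    ∀ e ∈ T.identities, ∀ x : ℕ → X, e.1.eval x = e.2.eval x := fun e he x =>
  hF _ _ fun i => by
    rw [Word.map_eval (F i) (h_add i) (h_un i) (h_bin i),
      Word.map_eval (F i) (h_add i) (h_un i) (h_bin i)]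
    exact (M i).sat e he _

lemma sat_of_surjective {X : Type*} [GroupWithOps T.Un T.Bin X] (M : T.Model) (F : M → X)
    (h_add : ∀ x y, F (x + y) = F x + F y)
    (h_un : ∀ (ω : T.Un) x, F (Model.un ω x) = GroupWithOps.un T.Bin ω (F x))
    (h_bin : ∀ (s : T.Bin) x y,
      F (Model.bin s x y) = GroupWithOps.bin T.Un s (F x) (F y))
    (hF : Function.Surjective F) :
    ∀ e ∈ T.identities, ∀ x : ℕ → X, e.1.eval x = e.2.eval x := fun e he x => by
  obtain ⟨y, hy⟩ : ∃ y : ℕ → M, x = fun i => F (y i) :=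
    ⟨fun i => (hF (x i)).choose, funext fun i => (hF (x i)).choose_spec.symm⟩
  rw [hy, ← Word.map_eval F h_add h_un h_bin, ← Word.map_eval F h_add h_un h_bin,
    M.sat e he]

namespace Model

instance (A B : T.Model) : FunLike (A ⟶ B) A B where
  coe f := Hom.toFun f
  coe_injective _ _ h := Hom.ext h

variable {A B D : T.Model}

instance : AddMonoidHomClass (A ⟶ B) A B where
  map_add f := Hom.map_add f
  map_zero f := map_zero (AddMonoidHom.mk' (Hom.toFun f) (Hom.map_add f))

@[ext]
lemma hom_ext {f g : A ⟶ B} (h : ∀ x, f x = g x) : f = g := DFunLike.ext _ _ h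

@[simp]
lemma comp_apply (f : A ⟶ B) (g : B ⟶ D) (x : A) : (f ≫ g) x = g (f x) := rfl

@[simp]
lemma id_apply (x : A) : (𝟙 A : A ⟶ A) x = x := rfl

@[simp]
lemma map_un (f : A ⟶ B) (ω : T.Un) (x : A) : f (un ω x) = un ω (f x) := Hom.map_un f ω x

@[simp]
lemma map_bin (f : A ⟶ B) (s : T.Bin) (x y : A) : f (bin s x y) = bin s (f x) (f y) :=
  Hom.map_bin f s x y

/-- Build a homomorphism. -/
def homMk (f : A → B) (h_add : ∀ x y, f (x + y) = f x + f y)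
    (h_un : ∀ (ω : T.Un) (x : A), f (un ω x) = un ω (f x))
    (h_bin : ∀ (s : T.Bin) (x y : A), f (bin s x y) = bin s (f x) (f y)) : A ⟶ B :=
  Hom.mk f h_add h_un h_bin

@[simp]
lemma homMk_apply (f : A → B) (h_add h_un h_bin) (x : A) :
    homMk f h_add h_un h_bin x = f x := rfl

lemma isIso_of_bijective (f : A ⟶ B) (hf : Function.Bijective f) : IsIso f := by
  obtain ⟨g, hg, hg'⟩ := Function.bijective_iff_has_inverse.1 hf
  refine ⟨homMk g (fun x y => hf.1 ?_) (fun ω x => hf.1 ?_) (fun s x y => hf.1 ?_), ?_, ?_⟩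
  · rw [map_add, hg', hg', hg']
  · rw [map_un, hg', hg']
  · rw [map_bin, hg', hg', hg']
  · ext x; exact hg x
  · ext x; exact hg' x

lemma bijective_of_isIso (f : A ⟶ B) [IsIso f] : Function.Bijective f :=
  Function.bijective_iff_has_inverse.2 ⟨inv f, fun x => by
    rw [← comp_apply, IsIso.hom_inv_id, id_apply], fun x => by
    rw [← comp_apply, IsIso.inv_hom_id, id_apply]⟩

/-! ### Products, submodels, quotients -/

/-- The product of two models. -/
def prodModel (A B : T.Model) : T.Model :=
  letI : GroupWithOps T.Un T.Bin (A × B) :=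
    { un := fun ω x => (un ω x.1, un ω x.2)
      bin := fun s x y => (bin s x.1 y.1, bin s x.2 y.2) }
  ⟨A × B, sat_of_jointly_injective (X := A × B) (ι := Bool) (fun b => bif b then A else B)
    (fun b => match b with | true => Prod.fst | false => Prod.snd)
    (by rintro (_ | _) x y <;> rfl) (by rintro (_ | _) ω x <;> rfl)
    (by rintro (_ | _) s x y <;> rfl) (fun x y h => Prod.ext (h true) (h false))⟩

/-- Pairs as elements of the product. -/
def pair (a : A) (b : B) : prodModel A B := (a, b)

/-- The first projection of the product. -/
def fst (A B : T.Model) : prodModel A B ⟶ A :=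
  homMk (A := prodModel A B) Prod.fst (fun _ _ => rfl) (fun _ _ => rfl) (fun _ _ _ => rfl)

/-- The second projection of the product. -/
def snd (A B : T.Model) : prodModel A B ⟶ B :=
  homMk (A := prodModel A B) Prod.snd (fun _ _ => rfl) (fun _ _ => rfl) (fun _ _ _ => rfl)

@[simp] lemma fst_pair (a : A) (b : B) : fst A B (pair a b) = a := rfl

@[simp] lemma snd_pair (a : A) (b : B) : snd A B (pair a b) = b := rfl

lemma prod_ext {x y : prodModel A B} (h₁ : fst A B x = fst A B y) (h₂ : snd A B x = snd A B y) :
    x = y := Prod.ext h₁ h₂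

/-- The universal property of the product. -/
def lift (f : D ⟶ A) (g : D ⟶ B) : D ⟶ prodModel A B :=
  homMk (B := prodModel A B) (fun x => pair (f x) (g x))
    (fun x y => prod_ext (map_add f x y) (map_add g x y))
    (fun ω x => prod_ext (map_un f ω x) (map_un g ω x))
    (fun s x y => prod_ext (map_bin f s x y) (map_bin g s x y))

@[simp] lemma lift_apply (f : D ⟶ A) (g : D ⟶ B) (x : D) : lift f g x = pair (f x) (g x) := rfl

/-- The one-element model. -/
def trivialModel : T.Model :=
  letI : GroupWithOps T.Un T.Bin PUnit.{w + 1} :=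
    { un := fun _ _ => PUnit.unit
      bin := fun _ _ _ => PUnit.unit }
  ⟨PUnit, fun _ _ _ => rfl⟩

instance : Subsingleton (trivialModel : T.Model) := inferInstanceAs (Subsingleton PUnit)

/-- A subset closed under all operations. -/
structure Submodel (A : T.Model) extends AddSubgroup A where
  un_mem : ∀ (ω : T.Un) {x : A}, x ∈ carrier → un ω x ∈ carrier
  bin_mem : ∀ (s : T.Bin) {x y : A}, x ∈ carrier → y ∈ carrier → bin s x y ∈ carrier

namespace Submodel

/-- A submodel as a model. -/
def toModel (S : Submodel A) : T.Model :=
  letI : GroupWithOps T.Un T.Bin S.toAddSubgroup :=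
    { un := fun ω x => ⟨un ω x.1, S.un_mem ω x.2⟩
      bin := fun s x y => ⟨bin s x.1 y.1, S.bin_mem s x.2 y.2⟩ }
  ⟨S.toAddSubgroup, sat_of_jointly_injective (ι := Unit) (fun _ => A) (fun _ => Subtype.val)
    (fun _ _ _ => rfl) (fun _ _ _ => rfl) (fun _ _ _ _ => rfl) (fun _ _ h => Subtype.ext (h ()))⟩

/-- The inclusion of a submodel. -/
def incl (S : Submodel A) : S.toModel ⟶ A :=
  homMk (A := S.toModel) Subtype.val (fun _ _ => rfl) (fun _ _ => rfl) (fun _ _ _ => rfl)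

lemma incl_injective (S : Submodel A) : Function.Injective S.incl := Subtype.val_injective

lemma incl_mem (S : Submodel A) (x : S.toModel) : S.incl x ∈ S.toAddSubgroup := Subtype.property x

lemma exists_incl (S : Submodel A) {x : A} (hx : x ∈ S.toAddSubgroup) :
    ∃ y : S.toModel, S.incl y = x := ⟨⟨x, hx⟩, rfl⟩

/-- Corestriction to a submodel. -/
def codRestrict (S : Submodel A) (f : D ⟶ A) (hf : ∀ x, f x ∈ S.toAddSubgroup) : D ⟶ S.toModel :=
  homMk (B := S.toModel) (fun x => ⟨f x, hf x⟩)
    (fun x y => S.incl_injective (map_add f x y))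
    (fun ω x => S.incl_injective (map_un f ω x))
    (fun s x y => S.incl_injective (map_bin f s x y))

end Submodel

/-- The range of a homomorphism. -/
def range (f : A ⟶ B) : Submodel B where
  __ := (f : A →+ B).range
  un_mem := by rintro ω _ ⟨x, rfl⟩; exact ⟨un ω x, map_un f ω x⟩
  bin_mem := by rintro s _ _ ⟨x, rfl⟩ ⟨y, rfl⟩; exact ⟨bin s x y, map_bin f s x y⟩

lemma mem_range {f : A ⟶ B} {y : B} : y ∈ (range f).toAddSubgroup ↔ ∃ x, f x = y := Iff.rfl

/-- The equalizer of two homomorphisms. -/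
def eqLocus (f g : A ⟶ B) : Submodel A where
  __ := (f : A →+ B).eqLocus (g : A →+ B)
  un_mem := fun ω x (hx : f x = g x) => show f _ = g _ by rw [map_un, map_un, hx]
  bin_mem := fun s x y (hx : f x = g x) (hy : f y = g y) => show f _ = g _ by
    rw [map_bin, map_bin, hx, hy]

lemma mem_eqLocus {f g : A ⟶ B} {x : A} : x ∈ (eqLocus f g).toAddSubgroup ↔ f x = g x := Iff.rfl

/-- A congruence on a model. -/
structure Congruence (A : T.Model) extends AddCon A where
  un' : ∀ (ω : T.Un) {x y : A}, r x y → r (un ω x) (un ω y)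
  bin' : ∀ (s : T.Bin) {x y x' y' : A}, r x y → r x' y' → r (bin s x x') (bin s y y')

namespace Congruence

instance (R : Congruence A) : GroupWithOps T.Un T.Bin R.toAddCon.Quotient where
  __ := (inferInstance : AddGroup R.toAddCon.Quotient)
  un ω := Quotient.map' (un ω) (fun _ _ h => R.un' ω h)
  bin s := Quotient.map₂ (bin s) (fun _ _ h _ _ h' => R.bin' s h h')

/-- The quotient by a congruence. -/
def quotient (R : Congruence A) : T.Model :=
  ⟨R.toAddCon.Quotient, sat_of_surjective A (fun x => (x : R.toAddCon.Quotient))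
    (fun _ _ => rfl) (fun _ _ => rfl) (fun _ _ _ => rfl) Quotient.mk_surjective⟩

/-- The quotient map of a congruence. -/
def proj (R : Congruence A) : A ⟶ R.quotient :=
  homMk (B := R.quotient) (fun x => (x : R.toAddCon.Quotient))
    (fun _ _ => rfl) (fun _ _ => rfl) (fun _ _ _ => rfl)

lemma proj_surjective (R : Congruence A) : Function.Surjective R.proj := Quotient.mk_surjective

lemma proj_eq_iff (R : Congruence A) {x y : A} : R.proj x = R.proj y ↔ R.toAddCon x y :=
  R.toAddCon.eq

end Congruence

/-- Homomorphisms descend along surjective homomorphisms. -/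
lemma exists_desc (f : A ⟶ B) (hf : Function.Surjective f) (g : A ⟶ D)
    (h : ∀ x y, f x = f y → g x = g y) : ∃ l : B ⟶ D, f ≫ l = g := by
  choose σ hσ using hf
  have hl : ∀ x, g (σ (f x)) = g x := fun x => h _ _ (hσ _)
  refine ⟨homMk (fun b => g (σ b)) (fun x y => ?_) (fun ω x => ?_) (fun s x y => ?_), ?_⟩
  · rw [← map_add]; exact h _ _ (by simp [hσ])
  · rw [← map_un]; exact h _ _ (by simp [hσ])
  · rw [← map_bin]; exact h _ _ (by simp [hσ])
  · ext x; exact hl x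

/-! ### Limits and colimits -/

instance : HasTerminal T.Model :=
  have (A : T.Model) : Unique (A ⟶ trivialModel) :=
    { default := homMk (fun _ => 0) (fun _ _ => Subsingleton.elim _ _)
        (fun _ _ => Subsingleton.elim _ _) (fun _ _ _ => Subsingleton.elim _ _)
      uniq := fun f => by ext x; exact Subsingleton.elim _ _ }
  hasTerminal_of_unique trivialModel

/-- The concrete pullback. Comparison with it gives every abstract pullback, and hence every kernel
pair, a description by elements. -/
lemma exists_isPullback (f : A ⟶ D) (g : B ⟶ D) :
    ∃ (P : T.Model) (p : P ⟶ A) (q : P ⟶ B), IsPullback p q f g ∧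
      (∀ x y, f x = g y → ∃ z, p z = x ∧ q z = y) ∧
      ∀ z z', p z = p z' → q z = q z' → z = z' := by
  let S := eqLocus (fst A B ≫ f) (snd A B ≫ g)
  refine ⟨S.toModel, S.incl ≫ fst A B, S.incl ≫ snd A B, ⟨⟨?_⟩, ⟨PullbackCone.IsLimit.mk _
    (fun s => S.codRestrict (lift s.fst s.snd) fun x => ?_) (fun s => rfl) (fun s => rfl) ?_⟩⟩, ?_,
    fun z z' h₁ h₂ => S.incl_injective (prod_ext h₁ h₂)⟩
  · ext x; exact S.incl_mem x
  · exact mem_eqLocus.2 congr($(s.condition) x)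
  · intro s m h₁ h₂
    ext x
    exact S.incl_injective (prod_ext congr($h₁ x) congr($h₂ x))
  · intro x y h
    obtain ⟨z, hz⟩ := S.exists_incl (x := pair x y) h
    exact ⟨z, by simp [hz], by simp [hz]⟩

instance : HasPullbacks T.Model :=
  have {X Y Z : T.Model} {f : X ⟶ Z} {g : Y ⟶ Z} : HasLimit (cospan f g) := by
    obtain ⟨P, p, q, h, -⟩ := exists_isPullback f g
    exact h.hasPullback
  hasPullbacks_of_hasLimit_cospan _

instance : HasFiniteLimits T.Model := hasFiniteLimits_of_hasTerminal_and_pullbacks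

lemma exists_of_isPullback {P : T.Model} {p : P ⟶ A} {q : P ⟶ B} {f : A ⟶ D} {g : B ⟶ D}
    (h : IsPullback p q f g) {x : A} {y : B} (hxy : f x = g y) : ∃ z, p z = x ∧ q z = y := by
  obtain ⟨P', p', q', h', he, -⟩ := exists_isPullback f g
  obtain ⟨z, rfl, rfl⟩ := he x y hxy
  exact ⟨h.lift p' q' h'.w z, by rw [← comp_apply, h.lift_fst], by rw [← comp_apply, h.lift_snd]⟩

lemma isPullback_ext {P : T.Model} {p : P ⟶ A} {q : P ⟶ B} {f : A ⟶ D} {g : B ⟶ D}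
    (h : IsPullback p q f g) {z z' : P} (h₁ : p z = p z') (h₂ : q z = q z') : z = z' := by
  obtain ⟨P', p', q', h', -, he⟩ := exists_isPullback f g
  apply (bijective_of_isIso (h.isoIsPullback _ _ h').hom).1
  apply he
  · simpa only [← comp_apply, IsPullback.isoIsPullback_hom_fst]
  · simpa only [← comp_apply, IsPullback.isoIsPullback_hom_snd]

lemma isPullback_of_elements {P : T.Model} {p : P ⟶ A} {q : P ⟶ B} {f : A ⟶ D} {g : B ⟶ D}
    (w : p ≫ f = q ≫ g) (h : ∀ x y, f x = g y → ∃ z, p z = x ∧ q z = y)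
    (h' : ∀ z z', p z = p z' → q z = q z' → z = z') : IsPullback p q f g := by
  let l : P ⟶ pullback f g := pullback.lift p q w
  have h₁ : l ≫ pullback.fst _ _ = p := pullback.lift_fst _ _ _
  have h₂ : l ≫ pullback.snd _ _ = q := pullback.lift_snd _ _ _
  have : IsIso l := by
    refine isIso_of_bijective _ ⟨fun z z' e => h' _ _ ?_ ?_, fun t => ?_⟩
    · rw [← h₁, comp_apply, e, comp_apply]
    · rw [← h₂, comp_apply, e, comp_apply]
    · obtain ⟨z, hz₁, hz₂⟩ := h _ _ congr($(pullback.condition (f := f) (g := g)) t)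
      refine ⟨z, isPullback_ext (IsPullback.of_hasPullback f g) ?_ ?_⟩
      · rw [← comp_apply, h₁, hz₁]; rfl
      · rw [← comp_apply, h₂, hz₂]; rfl
  exact IsPullback.of_iso_pullback ⟨w⟩ (asIso l) h₁ h₂

/-! ### Regular epimorphisms and exactness -/

lemma isRegularEpi_of_surjective (f : A ⟶ B) (hf : Function.Surjective f) : IsRegularEpi f := by
  have hd : ∀ {D : T.Model} (g : A ⟶ D), pullback.fst f f ≫ g = pullback.snd f f ≫ g →
      ∃ l, f ≫ l = g := fun g hg => exists_desc f hf g fun x y h => by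
    obtain ⟨z, rfl, rfl⟩ := exists_of_isPullback (IsPullback.of_hasPullback f f) h
    exact congr($hg z)
  choose d hd using @hd
  refine ⟨⟨⟨_, _, _, pullback.condition, Cofork.IsColimit.mk _ (fun s => d s.π s.condition)
    (fun s => hd s.π s.condition) fun s m hm => ?_⟩⟩⟩
  ext x
  obtain ⟨x, rfl⟩ := hf x
  exact congr($(hm.trans (hd s.π s.condition).symm) x)

/-- The inclusion of the range is a mono through which `f` factors, hence an isomorphism. -/
lemma surjective_of_strongEpi (f : A ⟶ B) [StrongEpi f] : Function.Surjective f := by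
  let e : A ⟶ (range f).toModel := (range f).codRestrict f fun x => ⟨x, rfl⟩
  have hf : e ≫ (range f).incl = f := rfl
  have : Mono (range f).incl := ⟨fun g h e => by
    ext x
    exact (range f).incl_injective congr($e x)⟩
  have : StrongEpi (e ≫ (range f).incl) := ‹_›
  have := strongEpi_of_strongEpi e (range f).incl
  have := isIso_of_mono_of_strongEpi (range f).incl
  intro y
  obtain ⟨x, rfl⟩ := (bijective_of_isIso (range f).incl).2 y
  exact (range f).incl_mem x

lemma injective_of_mono (f : A ⟶ B) [Mono f] : Function.Injective f := by
  intro x y h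
  obtain ⟨z, rfl, rfl⟩ := exists_of_isPullback (IsPullback.of_hasPullback f f) h
  have : pullback.fst f f = pullback.snd f f := by
    rw [← cancel_mono f, pullback.condition]
  rw [this]

/-- The congruence attached to an internal equivalence relation. -/
def congruenceOf {R X : T.Model} {p₁ p₂ : R ⟶ X} (e : EquivalenceRelation p₁ p₂) :
    Congruence X where
  r x y := ∃ z, p₁ z = x ∧ p₂ z = y
  iseqv := by
    refine ⟨fun x => ⟨e.r x, ?_, ?_⟩, ?_, ?_⟩
    · exact congr($(e.reflexivity₁) x)
    · exact congr($(e.reflexivity₂) x)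
    · rintro _ _ ⟨z, rfl, rfl⟩
      exact ⟨e.s z, congr($(e.symmetry₁) z), congr($(e.symmetry₂) z)⟩
    · rintro _ _ _ ⟨z, rfl, h⟩ ⟨z', h', rfl⟩
      obtain ⟨t, rfl, rfl⟩ := exists_of_isPullback (IsPullback.of_isLimit e.isLimit)
        (h.trans h'.symm)
      exact ⟨e.t t, congr($(e.transitivity₁) t), congr($(e.transitivity₂) t)⟩
  add' := by
    rintro _ _ _ _ ⟨z, rfl, rfl⟩ ⟨z', rfl, rfl⟩
    exact ⟨z + z', by simp, by simp⟩
  un' := by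
    rintro ω _ _ ⟨z, rfl, rfl⟩
    exact ⟨un ω z, by simp, by simp⟩
  bin' := by
    rintro s _ _ _ _ ⟨z, rfl, rfl⟩ ⟨z', rfl, rfl⟩
    exact ⟨bin s z z', by simp, by simp⟩

lemma isEffective {R X : T.Model} {p₁ p₂ : R ⟶ X} (e : EquivalenceRelation p₁ p₂) :
    IsEffectiveEquivalenceRelation p₁ p₂ := by
  let Q := congruenceOf e
  have hQ : ∀ x y, Q.proj x = Q.proj y ↔ ∃ z, p₁ z = x ∧ p₂ z = y := fun x y => Q.proj_eq_iff
  have hw : p₁ ≫ Q.proj = p₂ ≫ Q.proj := by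
    ext z
    exact (hQ _ _).2 ⟨z, rfl, rfl⟩
  have hm : Mono (lift p₁ p₂) := ⟨fun f g h => e.right_cancellation _ _
    (congr($h ≫ fst _ _)) (congr($h ≫ snd _ _))⟩
  have hk : IsKernelPair Q.proj p₁ p₂ := isPullback_of_elements hw (fun x y => (hQ x y).1)
    fun z z' h₁ h₂ => injective_of_mono (lift p₁ p₂) (prod_ext h₁ h₂)
  have hd : ∀ {D : T.Model} (g : X ⟶ D), p₁ ≫ g = p₂ ≫ g →
      ∃ l, Q.proj ≫ l = g := fun g hg => exists_desc _ Q.proj_surjective g fun x y h => by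
    obtain ⟨z, rfl, rfl⟩ := (hQ _ _).1 h
    exact congr($hg z)
  choose d hd using @hd
  have := isRegularEpi_of_surjective _ Q.proj_surjective
  -- Reflexivity forces the two legs of a cocone to agree, so the coequalizer is also the pushout.
  have hr : ∀ s : PushoutCocone p₁ p₂, s.inl = s.inr := fun s => by
    rw [← Category.id_comp s.inl, ← e.reflexivity₁, Category.assoc, s.condition,
      reassoc_of% e.reflexivity₂]
  have hs : ∀ s : PushoutCocone p₁ p₂, p₁ ≫ s.inl = p₂ ≫ s.inl := fun s =>
    s.condition.trans (by rw [hr])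
  exact ⟨⟨{ e with
    B := Q.quotient
    π := Q.proj
    isKernelPair := hk
    isPushout := ⟨⟨hw⟩, ⟨PushoutCocone.IsColimit.mk _ (fun s => d s.inl (hs s))
      (fun s => hd s.inl (hs s)) (fun s => (hd s.inl (hs s)).trans (hr s))
      (fun s m h₁ h₂ => by rw [← cancel_epi Q.proj, h₁, hd])⟩⟩ }⟩⟩

instance : BarrExact T.Model where
  hasCoequalizer_of_isKernelPair {X Y Z f g₁ g₂} h := by
    obtain ⟨⟨e⟩⟩ := isEffective (IsKernelPair.equivalenceRelation f g₁ g₂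
      (pullbackIsPullback g₂ g₁) h)
    exact ⟨_, e.isCoequalizer⟩
  regularEpiIsStableUnderBaseChange := ⟨fun {A B D P f g p q} h hf => by
    have : IsRegularEpi g := hf
    refine isRegularEpi_of_surjective _ fun y => ?_
    obtain ⟨x, hx⟩ := surjective_of_strongEpi g (f y)
    obtain ⟨z, -, hz⟩ := exists_of_isPullback h hx
    exact ⟨z, hz⟩⟩
  effective p₁ p₂ h := isEffective h.nonempty_equivalenceRelation.some

/-! ### Binary coproducts -/

/-- Two words in the elements of `A` and `B` are identified in the coproduct when they agree under
all pairs of homomorphisms to a third model. -/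
def wordSetoid (A B : T.Model) : Setoid (Word T.Un T.Bin (A ⊕ B)) where
  -- Quantifying over all models stays in `Prop`, so the quotient remains in `Type w`.
  r x y := ∀ (M : T.Model) (f : A ⟶ M) (g : B ⟶ M),
    x.eval (Sum.elim f g) = y.eval (Sum.elim f g)
  iseqv := ⟨fun _ _ _ _ => rfl, fun h M f g => (h M f g).symm,
    fun h h' M f g => (h M f g).trans (h' M f g)⟩

/-- The carrier of the coproduct. -/
def CoprodCarrier (A B : T.Model) : Type w := Quotient (wordSetoid A B)

namespace CoprodCarrier

instance : Add (CoprodCarrier A B) where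
  add := Quotient.map₂ Word.add fun _ _ h _ _ h' M f g => by simp [Word.eval, h M f g, h' M f g]

instance : Zero (CoprodCarrier A B) where
  zero := Quotient.mk _ Word.zero

instance : Neg (CoprodCarrier A B) where
  neg := Quotient.map Word.neg fun _ _ h M f g => by simp [Word.eval, h M f g]

instance : GroupWithOps T.Un T.Bin (CoprodCarrier A B) where
  __ := AddGroup.ofLeftAxioms (G := CoprodCarrier A B)
    (by rintro ⟨x⟩ ⟨y⟩ ⟨z⟩; exact Quotient.sound fun M f g => add_assoc _ _ _)
    (by rintro ⟨x⟩; exact Quotient.sound fun M f g => zero_add _)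
    (by rintro ⟨x⟩; exact Quotient.sound fun M f g => neg_add_cancel _)
  un ω := Quotient.map (Word.un ω) fun _ _ h M f g => by simp [Word.eval, h M f g]
  bin s := Quotient.map₂ (Word.bin s) fun _ _ h _ _ h' M f g => by
    simp [Word.eval, h M f g, h' M f g]

/-- Evaluation of (classes of) words. -/
def eval {M : T.Model} (f : A ⟶ M) (g : B ⟶ M) : CoprodCarrier A B → M :=
  Quotient.lift (Word.eval (Sum.elim f g)) fun _ _ h => h M f g

end CoprodCarrier

/-- The coproduct of two models. -/
def coprodModel (A B : T.Model) : T.Model :=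
  ⟨CoprodCarrier A B, sat_of_jointly_injective
    (ι := Σ M : T.Model, (A ⟶ M) × (B ⟶ M)) (fun i => i.1)
    (fun i => CoprodCarrier.eval i.2.1 i.2.2) (by rintro i ⟨x⟩ ⟨y⟩; rfl) (by rintro i ω ⟨x⟩; rfl)
    (by rintro i s ⟨x⟩ ⟨y⟩; rfl) (by
      rintro ⟨x⟩ ⟨y⟩ h
      exact Quotient.sound fun M f g => h ⟨M, f, g⟩)⟩

/-- The first injection of the coproduct. -/
def inl (A B : T.Model) : A ⟶ coprodModel A B :=
  homMk (B := coprodModel A B) (fun a => Quotient.mk (wordSetoid A B) (Word.var (Sum.inl a)))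
    (fun x y => Quotient.sound fun _ f _ => map_add f x y)
    (fun ω x => Quotient.sound fun _ f _ => map_un f ω x)
    (fun s x y => Quotient.sound fun _ f _ => map_bin f s x y)

/-- The second injection of the coproduct. -/
def inr (A B : T.Model) : B ⟶ coprodModel A B :=
  homMk (B := coprodModel A B) (fun b => Quotient.mk (wordSetoid A B) (Word.var (Sum.inr b)))
    (fun x y => Quotient.sound fun _ _ g => map_add g x y)
    (fun ω x => Quotient.sound fun _ _ g => map_un g ω x)
    (fun s x y => Quotient.sound fun _ _ g => map_bin g s x y)

/-- The universal property of the coproduct. -/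
def desc {M : T.Model} (f : A ⟶ M) (g : B ⟶ M) : coprodModel A B ⟶ M :=
  homMk (A := coprodModel A B) (CoprodCarrier.eval f g)
    (by rintro ⟨x⟩ ⟨y⟩; rfl) (by rintro ω ⟨x⟩; rfl) (by rintro s ⟨x⟩ ⟨y⟩; rfl)

lemma coprod_hom_ext {M : T.Model} {h h' : coprodModel A B ⟶ M}
    (h₁ : inl A B ≫ h = inl A B ≫ h') (h₂ : inr A B ≫ h = inr A B ≫ h') : h = h' := by
  ext x
  obtain ⟨x⟩ := x
  induction x with
  | var i =>
    obtain a | b := i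
    · exact congr($h₁ a)
    · exact congr($h₂ b)
  | zero => exact (map_zero h).trans (map_zero h').symm
  | add a b ha hb => exact (map_add h _ _).trans ((congr($ha + $hb)).trans (map_add h' _ _).symm)
  | neg a ha => exact (map_neg h _).trans ((congr(- $ha)).trans (map_neg h' _).symm)
  | un ω a ha => exact (map_un h ω _).trans ((congr(un ω $ha)).trans (map_un h' ω _).symm)
  | bin s a b ha hb =>
    exact (map_bin h s _ _).trans ((congr(bin s $ha $hb)).trans (map_bin h' s _ _).symm)

instance : HasBinaryCoproducts T.Model :=
  have {A B : T.Model} : HasColimit (Limits.pair A B) := ⟨⟨⟨BinaryCofan.mk (inl A B) (inr A B),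
    BinaryCofan.IsColimit.mk _ (fun f g => desc f g) (fun _ _ => rfl) (fun _ _ => rfl)
      fun _ _ _ h₁ h₂ => coprod_hom_ext h₁ h₂⟩⟩⟩
  hasBinaryCoproducts_of_hasColimit_pair _

end Model

end Theory

/-! ### Commutators, products and the operations in a category of interest. -/

namespace Theory

variable {T : Theory.{w}}

namespace Model

variable {A B D : T.Model}

lemma mono_incl (S : Submodel A) : Mono S.incl := ⟨fun g h e => by
  ext x
  exact S.incl_injective congr($e x)⟩

/-- An additive subgroup containing all commutators and products. -/
structure ContainsCommutators (H : AddSubgroup A) : Prop where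
  add_mem : ∀ x y : A, x + y - x - y ∈ H
  bin_mem : ∀ (s : T.Bin) (x y : A), bin s x y ∈ H

/-- The additive subgroup generated by commutators and products. -/
def derived (A : T.Model) : AddSubgroup A :=
  AddSubgroup.closure ({z | ∃ x y : A, x + y - x - y = z} ∪
    {z | ∃ (s : T.Bin) (x y : A), bin s x y = z})

lemma containsCommutators_derived (A : T.Model) : ContainsCommutators (derived A) :=
  ⟨fun x y => AddSubgroup.subset_closure (Or.inl ⟨x, y, rfl⟩),
    fun s x y => AddSubgroup.subset_closure (Or.inr ⟨s, x, y, rfl⟩)⟩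

lemma derived_le {H : AddSubgroup A} (h : ContainsCommutators H) : derived A ≤ H := by
  refine (AddSubgroup.closure_le _).2 ?_
  rintro _ (⟨x, y, rfl⟩ | ⟨s, x, y, rfl⟩)
  · exact h.add_mem x y
  · exact h.bin_mem s x y

/-- `g + n - g = (g + n - g - n) + n`. -/
instance (A : T.Model) : (derived A).Normal := ⟨fun n hn g => by
  have := add_mem ((containsCommutators_derived A).add_mem g n) hn
  rwa [sub_add_cancel, sub_eq_add_neg] at this⟩

section OfInterest

variable [hT : Fact T.IsOfInterest]

lemma bin_add (s : T.Bin) (x y z : A) : bin s x (y + z) = bin s x y + bin s x z :=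
  hT.out.bin_add s A x y z

lemma exists_opposite (s : T.Bin) :
    ∃ s' : T.Bin, ∀ (A : T.Model) (x y : A), bin s' x y = bin s y x := hT.out.opposite s

lemma add_bin (s : T.Bin) (x y z : A) : bin s (x + y) z = bin s x z + bin s y z := by
  obtain ⟨s', h⟩ := exists_opposite s
  simp only [← h, bin_add]

lemma un_add (ω : T.Un) (x y : A) : un ω (x + y) = un ω x + un ω y := hT.out.un_add ω A x y

/-- A unary operation as an additive homomorphism. -/
def unHom (A : T.Model) (ω : T.Un) : A →+ A := AddMonoidHom.mk' (un ω) (un_add ω)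

/-- Left multiplication as an additive homomorphism. -/
def binLeft (s : T.Bin) (x : A) : A →+ A := AddMonoidHom.mk' (bin s x) (bin_add s x)

/-- Right multiplication as an additive homomorphism. -/
def binRight (s : T.Bin) (y : A) : A →+ A := AddMonoidHom.mk' (bin s · y) (add_bin s · · y)

@[simp] lemma un_zero (ω : T.Un) : un ω (0 : A) = 0 := map_zero (unHom A ω)

@[simp] lemma bin_zero (s : T.Bin) (x : A) : bin s x 0 = 0 := map_zero (binLeft s x)

@[simp] lemma zero_bin (s : T.Bin) (x : A) : bin s 0 x = 0 := map_zero (binRight s x)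

lemma un_neg (ω : T.Un) (x : A) : un ω (-x) = -un ω x := map_neg (unHom A ω) x

lemma un_bin (ω : T.Un) (s : T.Bin) (x y : A) : bin s (un ω x) y = un ω (bin s x y) :=
  hT.out.un_bin ω s A x y

lemma add_bin_comm (s : T.Bin) (x y z : A) : x + bin s y z = bin s y z + x :=
  hT.out.add_bin s A x y z

lemma eval_zero {V : Type*} (W : Word T.Un T.Bin V) : W.eval (fun _ => (0 : A)) = 0 := by
  induction W with
  | var i => rfl
  | zero => rfl
  | add a b ha hb => simp [Word.eval, ha, hb]
  | neg a ha => simp [Word.eval, ha]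
  | un ω a ha => rw [Word.eval, ha]; exact un_zero ω
  | bin s a b ha hb => rw [Word.eval, ha, hb]; exact bin_zero s 0

/-! ### Semi-abelianness and centrality by elements. -/

instance : HasZeroMorphisms T.Model where
  zero A B := ⟨homMk (fun _ => 0) (by simp) (by simp) (by simp)⟩
  comp_zero _ _ := rfl
  zero_comp _ _ _ f := by ext; exact map_zero f

@[simp] lemma zero_apply (x : A) : (0 : A ⟶ B) x = 0 := rfl

lemma exists_kernel_ι (f : A ⟶ B) {x : A} (hx : f x = 0) : ∃ z, kernel.ι f z = x := by
  let S := eqLocus f 0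
  have h : S.incl ≫ f = 0 := by ext x; exact S.incl_mem x
  obtain ⟨z, rfl⟩ := S.exists_incl (x := x) hx
  exact ⟨kernel.lift f S.incl h z, by rw [← comp_apply, kernel.lift_ι]⟩

lemma kernel_ι_apply (f : A ⟶ B) (z : (kernel f : T.Model)) : f (kernel.ι f z) = 0 :=
  congr($(kernel.condition f) z)

instance : SemiAbelian T.Model where
  hasZeroObject := hasZeroObject_of_hasTerminal_object
  hasBinaryCoproducts := inferInstance
  protomodular {X' Y' X Y} f' s' f s θ φ hs' hs hf hsθ hφ hk := by
    have hm : ∀ k, θ (kernel.ι f' k) = kernel.ι f (kernel.map f' f θ φ hf k) := fun k =>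
      congr($((kernel.lift_ι f (kernel.ι f' ≫ θ) (by simp [← hf])).symm) k)
    have hφ := bijective_of_isIso φ
    have hk := bijective_of_isIso (kernel.map f' f θ φ hf)
    have hf (x) : φ (f' x) = f (θ x) := congr($hf x)
    refine isIso_of_bijective θ ⟨(injective_iff_map_eq_zero θ).2 fun a ha => ?_, fun x => ?_⟩
    · obtain ⟨k, rfl⟩ := exists_kernel_ι f' (x := a) (hφ.1 (by rw [hf, ha, map_zero, map_zero]))
      rw [hm] at ha
      have h0 := injective_of_mono (kernel.ι f) (ha.trans (map_zero _).symm)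
      rw [hk.1 (h0.trans (map_zero _).symm), map_zero]
    · obtain ⟨y, hy⟩ := hφ.2 (f x)
      -- Surjectivity comes from the decomposition `x = (x - s (f x)) + s (f x)`.
      obtain ⟨k, hk'⟩ := exists_kernel_ι f (x := x - s (f x)) (by
        rw [map_sub, ← comp_apply s, hs, id_apply, sub_self])
      obtain ⟨k, rfl⟩ := hk.2 k
      refine ⟨kernel.ι f' k + s' y, ?_⟩
      rw [map_add, hm, hk', ← comp_apply s', hsθ, comp_apply, hy, sub_add_cancel]

/-- Elements which commute with and annihilate everything. -/
def IsCentral (z : A) : Prop := (∀ x, x + z = z + x) ∧ ∀ (s : T.Bin) (x : A), bin s x z = 0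

lemma IsCentral.bin_eq_zero {z : A} (hz : IsCentral z) (s : T.Bin) (x : A) : bin s z x = 0 := by
  obtain ⟨s', h⟩ := exists_opposite s
  rw [← h, hz.2]

lemma isCentral_zero : IsCentral (0 : A) := ⟨by simp, by simp⟩

lemma IsCentral.add {z z' : A} (hz : IsCentral z) (hz' : IsCentral z') : IsCentral (z + z') :=
  ⟨fun x => by rw [← add_assoc, hz.1, add_assoc, hz'.1, add_assoc], fun s x => by
    rw [bin_add, hz.2, hz'.2, add_zero]⟩

lemma IsCentral.neg {z : A} (hz : IsCentral z) : IsCentral (-z) :=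
  ⟨fun x => (AddCommute.neg_right (show AddCommute x z from hz.1 x)).eq, fun s x => by
    rw [show bin s x (-z) = - bin s x z from map_neg (binLeft s x) z, hz.2, neg_zero]⟩

/-- In `X × K` the elements `(x, 0)` and `(0, z)` commute and have product zero, and a cooperator
preserves this. Conversely centrality makes `(x, z) ↦ x + k z` a homomorphism. -/
lemma nonempty_cooperator_iff {K X : T.Model} (k : K ⟶ X) :
    Nonempty (Cooperator k) ↔ ∀ z, IsCentral (k z) := by
  constructor
  · rintro ⟨c⟩ z
    let ψ : prodModel X K ⟶ X := prod.lift (fst X K) (snd X K) ≫ c.φ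
    have h₁ : ∀ x, ψ (pair x 0) = x := fun x =>
      congr($(show lift (𝟙 X) 0 ≫ ψ = 𝟙 X by
        refine Eq.trans ?_ c.inl
        rw [← Category.assoc, prod.comp_lift]; rfl) x)
    have h₂ : ∀ z, ψ (pair 0 z) = k z := fun z =>
      congr($(show lift 0 (𝟙 K) ≫ ψ = k by
        refine Eq.trans ?_ c.inr
        rw [← Category.assoc, prod.comp_lift]; rfl) z)
    refine ⟨fun x => ?_, fun s x => ?_⟩
    · rw [← h₁ x, ← h₂, ← map_add, ← map_add]
      congr 1
      refine prod_ext ?_ ?_ <;> simp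
    · rw [← h₁ x, ← h₂, ← map_bin, ← map_zero ψ]
      congr 1
      refine prod_ext ?_ ?_ <;> simp
  · intro h
    let ψ : prodModel X K ⟶ X := homMk (fun p => fst X K p + k (snd X K p))
      (fun p q => by
        rw [map_add, map_add, map_add, add_assoc, add_assoc, ← add_assoc (k _) (fst X K q),
          ← (h (snd X K p)).1 (fst X K q), add_assoc])
      (fun ω p => by rw [map_un, map_un, map_un, un_add])
      (fun s p q => by
        rw [map_bin, map_bin, map_bin, bin_add, (h (snd X K q)).2, add_bin,
          (h _).bin_eq_zero, (h _).2, add_zero, add_zero])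
    refine ⟨⟨lift prod.fst prod.snd ≫ ψ, ?_, ?_⟩⟩
    · have : prod.lift (𝟙 X) (0 : X ⟶ K) ≫ lift prod.fst prod.snd = lift (𝟙 X) 0 := by
        change lift (prod.lift (𝟙 X) (0 : X ⟶ K) ≫ prod.fst)
          (prod.lift (𝟙 X) (0 : X ⟶ K) ≫ prod.snd) = _
        rw [prod.lift_fst, prod.lift_snd]
      rw [← Category.assoc, this]
      ext x
      simp [ψ]
    · have : prod.lift (0 : K ⟶ X) (𝟙 K) ≫ lift prod.fst prod.snd = lift 0 (𝟙 K) := by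
        change lift (prod.lift (0 : K ⟶ X) (𝟙 K) ≫ prod.fst)
          (prod.lift (0 : K ⟶ X) (𝟙 K) ≫ prod.snd) = _
        rw [prod.lift_fst, prod.lift_snd]
      rw [← Category.assoc, this]
      ext x
      simp [ψ]

/-! ### Centres in a category of interest. -/

/-- Iterated unary operations. -/
def unList (A : T.Model) : List T.Un → A →+ A
  | [] => AddMonoidHom.id A
  | ω :: l => (unList A l).comp (unHom A ω)

lemma unList_mem {S : Submodel A} (l : List T.Un) {x : A} (hx : x ∈ S.toAddSubgroup) :
    unList A l x ∈ S.toAddSubgroup := by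
  induction l generalizing x with
  | nil => exact hx
  | cons ω l ih => exact ih (S.un_mem ω hx)

/-- The centre of a model: the elements all of whose images under unary operations are central. -/
def centreModel (A : T.Model) : Submodel A where
  -- A unary operation need not preserve commuting with every element, so all iterates are imposed
  -- to obtain a submodel.
  carrier := {z | ∀ l, IsCentral (unList A l z)}
  zero_mem' l := by rw [map_zero]; exact isCentral_zero
  add_mem' hx hy l := by rw [map_add]; exact (hx l).add (hy l)
  neg_mem' hx l := by rw [map_neg]; exact (hx l).neg
  un_mem ω x hx l := hx (ω :: l)
  bin_mem s x y _ hy l := by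
    rw [show bin s x y = 0 from (hy []).2 s x, map_zero]; exact isCentral_zero

theorem admitsCentres : AdmitsCentres T.Model := fun X => by
  have := mono_incl (centreModel X)
  refine ⟨Subobject.mk (centreModel X).incl, ?_, fun Z hZ => ?_⟩
  · refine (higgins_top_eq_bot_iff _).2 ?_
    rw [← Subobject.underlyingIso_hom_comp_eq_mk]
    obtain ⟨c⟩ := (nonempty_cooperator_iff (centreModel X).incl).2 fun z =>
      (centreModel X).incl_mem z []
    exact ⟨c.comp _⟩
  · have h := (nonempty_cooperator_iff _).1 ((higgins_top_eq_bot_iff _).1 hZ)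
    refine Subobject.le_mk_of_comm ((centreModel X).codRestrict Z.arrow fun x l => ?_) rfl
    -- The image of `Z` is closed under unary operations, so the iterates of its elements are
    -- central as well.
    obtain ⟨y, hy⟩ := mem_range.1 (unList_mem (S := range Z.arrow) l ⟨x, rfl⟩)
    exact (congrArg IsCentral hy).mp (h y)

/-! ### Perfect models and the condition (UCE). -/

lemma un_mem_derived (ω : T.Un) {x : A} (hx : x ∈ derived A) : un ω x ∈ derived A := by
  have : derived A ≤ (derived A).comap (unHom A ω) := by
    refine derived_le ⟨fun x y => ?_, fun s x y => ?_⟩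
    · rw [AddSubgroup.mem_comap, map_sub, map_sub, map_add]
      exact (containsCommutators_derived A).add_mem _ _
    · change un ω (bin s x y) ∈ derived A
      rw [← un_bin]
      exact (containsCommutators_derived A).bin_mem s _ _
  exact this hx

/-- The congruence modulo commutators and products. -/
def derivedCongruence (A : T.Model) : Congruence A where
  __ := QuotientAddGroup.con (derived A)
  un' ω x y h := by
    refine QuotientAddGroup.leftRel_apply.2 ?_
    rw [← un_neg, ← un_add]
    exact un_mem_derived ω (QuotientAddGroup.leftRel_apply.1 h)
  bin' s x y x' y' h h' := QuotientAddGroup.leftRel_apply.2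
    (add_mem (neg_mem ((containsCommutators_derived A).bin_mem s _ _))
      ((containsCommutators_derived A).bin_mem s _ _))

lemma derived_proj_eq_zero {x : A} : (derivedCongruence A).proj x = 0 ↔ x ∈ derived A := by
  rw [eq_comm, ← map_zero (derivedCongruence A).proj, Congruence.proj_eq_iff]
  refine QuotientAddGroup.leftRel_apply.trans ?_
  rw [neg_zero, zero_add]

lemma isCentral_derived_quotient (z : (derivedCongruence A).quotient) : IsCentral z := by
  obtain ⟨z, rfl⟩ := (derivedCongruence A).proj_surjective z
  refine ⟨fun x => ?_, fun s x => ?_⟩ <;>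
    obtain ⟨x, rfl⟩ := (derivedCongruence A).proj_surjective x
  · rw [← sub_eq_zero, ← map_add, ← map_add, ← map_sub, derived_proj_eq_zero]
    simpa [sub_eq_add_neg, add_assoc] using (containsCommutators_derived A).add_mem x z
  · rw [← map_bin, derived_proj_eq_zero]
    exact (containsCommutators_derived A).bin_mem s x z

/-- The quotient by `derived A` is perfect, but all its elements are central, so its commutator is
zero and it vanishes. -/
lemma derived_eq_top (hA : IsPerfect A) : derived A = ⊤ := by
  set R := derivedCongruence A
  have := isRegularEpi_of_surjective _ R.proj_surjective
  have hP := hA.of_regularEpi R.proj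
  have hbot := (higgins_top_eq_bot_iff (⊤ : Subobject R.quotient)).2
    ((nonempty_cooperator_iff _).2 fun z => isCentral_derived_quotient _)
  have h0 : ∀ S : Subobject R.quotient, S = ⊥ → S.arrow = 0 := by
    rintro _ rfl
    exact Subobject.bot_arrow
  have h := h0 ⊤ (hP.symm.trans hbot)
  refine eq_top_iff.2 fun x _ => derived_proj_eq_zero.1 ?_
  obtain ⟨y, hy⟩ := (bijective_of_isIso (⊤ : Subobject R.quotient).arrow).2 (R.proj x)
  rw [← hy, h, zero_apply]

/-- The image of `H` contains `derived B`, which is all of `B`, and `H` contains the kernel of `f`.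
-/
lemma eq_top_of_containsCommutators (hB : IsPerfect B) (f : A ⟶ B) (hf : Function.Surjective f)
    (H : AddSubgroup A) (hH : ∀ x, f x = 0 → x ∈ H) (h : ContainsCommutators H) (x : A) :
    x ∈ H := by
  have : derived B ≤ H.map (f : A →+ B) := by
    refine derived_le ⟨fun x y => ?_, fun s x y => ?_⟩ <;>
      obtain ⟨x, rfl⟩ := hf x <;> obtain ⟨y, rfl⟩ := hf y
    · exact ⟨_, h.add_mem x y, by simp⟩
    · exact ⟨_, h.bin_mem s x y, by simp⟩
  rw [derived_eq_top hB] at this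
  obtain ⟨y, hy, hxy⟩ := this (AddSubgroup.mem_top (f x))
  have h1 := hH (x - y) (by rw [map_sub, sub_eq_zero]; exact hxy.symm)
  simpa using add_mem h1 hy

lemma isCentral_of_comp (hB : IsPerfect B) (f : A ⟶ B) (hf : Function.Surjective f)
    (hfc : ∀ x, f x = 0 → IsCentral x) {k : A} (hk : IsCentral (f k)) : IsCentral k := by
  constructor
  · have hδ : ∀ x, IsCentral (x + k - x - k) := fun x => hfc _ (by
      rw [map_sub, map_sub, map_add, hk.1, add_sub_cancel_right, sub_self])
    -- Additivity holds because the values of `δ` lie in the kernel of `f`, hence are central; for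
    -- the same reason `δ` kills commutators.
    let δ : A →+ A := AddMonoidHom.mk' (fun x => x + k - x - k) fun x y => by
      have h : y + k - y = (y + k - y - k) + k := by simp
      calc x + y + k - (x + y) - k = x + (y + k - y) - x - k := by
            simp [sub_eq_add_neg, add_assoc]
        _ = (x + (y + k - y - k)) + k - x - k := by rw [h]; simp [add_assoc]
        _ = (y + k - y - k) + (x + k - x - k) := by
          rw [(hδ y).1]; simp only [sub_eq_add_neg, add_assoc]
        _ = _ := ((hδ y).1 _).symm
    have hmem : ∀ x, x ∈ δ.ker ↔ x + k = k + x := fun x => by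
      rw [AddMonoidHom.mem_ker]
      change x + k - x - k = 0 ↔ _
      rw [sub_eq_zero, sub_eq_iff_eq_add]
    intro x
    rw [← hmem]
    refine eq_top_of_containsCommutators hB f hf _ (fun x hx => (hmem x).2 ((hfc x hx).1 k).symm)
      ⟨fun x y => ?_, fun s x y => (hmem _).2 (add_bin_comm s k x y).symm⟩ x
    rw [AddMonoidHom.mem_ker, map_sub, map_sub, map_add,
      show δ x + δ y = δ y + δ x from (hδ y).1 _]
    simp
  · intro s x
    change x ∈ (binRight s k).ker
    refine eq_top_of_containsCommutators hB f hf _ (fun x hx => (hfc x hx).bin_eq_zero s k)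
      ⟨fun x y => ?_, fun t x y => ?_⟩ x
    · rw [AddMonoidHom.mem_ker, map_sub, map_sub, map_add,
        show binRight s k x + binRight s k y = binRight s k y + binRight s k x from
          add_bin_comm s _ y k]
      simp
    · obtain ⟨W, hW⟩ := hT.out.bin_bin t s
      refine (hW A x y k).trans ?_
      have h₁ : ∀ r (a : A), IsCentral (bin r k a) := fun r a => hfc _ (by
        rw [map_bin, hk.bin_eq_zero])
      have h₂ : ∀ r (a : A), IsCentral (bin r a k) := fun r a => hfc _ (by
        rw [map_bin, hk.2])
      have h0 : ∀ v : Fin 8 × T.Bin × T.Bin, monomial x y k v.2.1 v.2.2 v.1 = 0 := by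
        rintro ⟨i, r, r'⟩
        fin_cases i <;> simp [monomial, (h₁ _ _).2, (h₂ _ _).2, (h₁ _ _).bin_eq_zero,
          (h₂ _ _).bin_eq_zero]
      simp only [h0, eval_zero]

lemma IsCentralExtension.isCentral {f : A ⟶ B} (hf : IsCentralExtension f) {x : A}
    (hx : f x = 0) : IsCentral x := by
  obtain ⟨z, rfl⟩ := exists_kernel_ι f hx
  exact (nonempty_cooperator_iff _).1
    (exists_cooperator_of_isCentralExtension hf _ (kernel.condition f)) z

theorem uce : UCE T.Model := fun {A B D} f g hf hg hB => by
  have := hf.1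
  have := hg.1
  have : StrongEpi (f ≫ g) := strongEpi_comp f g
  obtain ⟨c⟩ := (nonempty_cooperator_iff (kernel.ι (f ≫ g))).2 fun z =>
    isCentral_of_comp hB f (surjective_of_strongEpi f)
      (fun x hx => IsCentralExtension.isCentral hf hx)
      (IsCentralExtension.isCentral hg (kernel_ι_apply (f ≫ g) z))
  exact c.isCentralExtension_of_kernel

end OfInterest

end Model

end Theory
end SemiAb

theorem mainTheorem7 :
    (∀ (C : Type u) [Category.{v} C] [HasZeroMorphisms C] [SemiAb.SemiAbelian C]
      (hC : SemiAb.AdmitsCentres C), SemiAb.UCE C → ∀ P : C, SemiAb.IsPerfect P →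
        ∃ _ : HasCokernel (SemiAb.centre hC P).arrow,
          SemiAb.centre hC (cokernel (SemiAb.centre hC P).arrow) = ⊥) ∧
    (∀ T : SemiAb.Theory.{w}, T.IsOfInterest →
      ∃ (_ : HasZeroMorphisms T.Model) (_ : SemiAb.SemiAbelian T.Model),
        SemiAb.AdmitsCentres T.Model ∧ SemiAb.UCE T.Model) := by
  refine ⟨fun C _ _ _ hC hU P hP => ?_, fun T hT => ?_⟩
  · have := SemiAb.hasCokernel_centre hC P
    exact ⟨this, SemiAb.centre_cokernel_centre hC hU P hP⟩
  · have : Fact T.IsOfInterest := ⟨hT⟩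
    exact ⟨inferInstance, inferInstance, SemiAb.Theory.Model.admitsCentres,
      SemiAb.Theory.Model.uce⟩
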